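/- Fix $d\ge 3$. For $a,b\in\mathbb R^d$ the stair-path $\sigma(a,b)$ is defined by induction on $d$: for $d=1$ it is the segment $ab$; for $d\ge2$, assuming (after interchanging $a$ and $b$ if necessary) that $a_d\le b_d$, it is the union of the segment $aa'$, where $a'=(a_1,\dots,a_{d-1},b_d)$, and the stair-path $\sigma(a',b)$, obtained by ignoring the common last coordinate. A set is stair-convex if it contains $\sigma(a,b)$ for all its points $a,b$, and $\mathrm{stconv}(S)$ is the intersection of all stair-convex sets containing $S$. For each $n$, let $x_{i,1}<\dots<x_{i,n}$ ($1\le i\le d$) be the axes of an arbitrary stretched grid: $x_{i,1}=1$ and $K_i x_{i,j}\le x_{i,j+1}$ for $1\le j<n$, where $K_1=2^d$ and $K_i=2^d x_{i-1,n}$ for $i\ge2$. Let $D_s(n)=\{(x_{1,j},\dots,x_{d,j}):1\le j\le n\}$ be the $n$-point stretched diagonal. Put $$q=\Bigl(1,\tfrac{3}{d+2},\tfrac{4}{d+2},\dots,\tfrac{d+1}{d+2}\Bigr),\qquad p=\Bigl(\tfrac1{d+2},\tfrac2{d+2},\dots,\tfrac{d-1}{d+2},\tfrac{d-1}{d+2}\Bigr).$$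 Say that $u'\in\prod_i[1,x_{i,n}]$ corresponds to $u\in[0,1]^d$ if, for every $i$ and every $1\le j\le n$, $x_{i,j}\le u'_i$ whenever $j\le u_in$, and $u'_i\le x_{i,j}$ whenever $j>u_in$ (that is, $x_{i,\lfloor u_in\rfloor}\le u'_i\le x_{i,\lfloor u_in\rfloor+1}$, as far as these are defined). (1) For every $n\ge 1$ there are points $q',p'$ corresponding to $q,p$. For every choice of such points for all $n\ge1$, the stair-path $\sigma(q',p')$ meets $\frac{n^d}{(d+2)^{d-1}}-o(n^d)$ of the $(d-1)$-dimensional stair-simplices $\mathrm{stconv}(Z)$, $Z\subseteq D_s(n)$, $|Z|=d$, where $o(n^d)$ is an error term of either sign. (2) For every such choice, the straight line through $q'$ and $p'$ meets at least $\frac{n^d}{(d+2)^{d-1}}-o(n^d)$ of the $(d-1)$-dimensional simplices spanned by $D_s(n)$, i.e. convex hulls of $d$ affinely independent points of $D_s(n)$. (3) Consequently, if every line meets at most $c\,n^d+o(n^d)$ of the $(d-1)$-dimensional simplices spanned by $D_s(n)$ (with the same error term for all lines), so that the stretched diagonal yields the upper bound $c_{d,1}\le c$, then $c\ge\frac1{(d+2)^{d-1}}$.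 In particular, this bound is worse than the values found numerically for the stretched grid in dimensions $4,5,6$: $c>0.00457936$ if $d=4$, $c>0.000405335$ if $d=5$, and $c>0.0000291323$ if $d=6$. (Here $c_{d,1}$ denotes the largest constant such that every $n$-point set in general position in $\mathbb R^d$ admits a line that meets at least $c_{d,1}n^d-o(n^d)$ of the $(d-1)$-dimensional simplices spanned by it.) -/

import Mathlib

open Asymptotics Filter

noncomputable section

namespace StairConvex

/-! ### Stair-convexity

Points of `ℝ^d` are functions `Fin d → ℝ`; the `i`-th coordinate of the literature is the coordinate
with index `i - 1`, and the last coordinate is the height. -/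

/-- The stair-path `σ(a, b)` between two points of `ℝ^d`. In dimension `1` it is the segment `ab`.
In dimension `≥ 2`, the lower of the two points goes up vertically to the height of the higher one,
and then the stair-path one dimension lower is followed at that constant height.
(In dimension `0` the space is a single point.) -/
def stairPath : (d : ℕ) → (Fin d → ℝ) → (Fin d → ℝ) → Set (Fin d → ℝ)
  | 0, _, _ => Set.univ
  | 1, a, b => segment ℝ a b
  | d + 2, a, b =>
      if a (Fin.last (d + 1)) ≤ b (Fin.last (d + 1)) then
        segment ℝ a (Fin.snoc (Fin.init a) (b (Fin.last (d + 1)))) ∪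
          {z | z (Fin.last (d + 1)) = b (Fin.last (d + 1)) ∧
            Fin.init z ∈ stairPath (d + 1) (Fin.init a) (Fin.init b)}
      else
        segment ℝ b (Fin.snoc (Fin.init b) (a (Fin.last (d + 1)))) ∪
          {z | z (Fin.last (d + 1)) = a (Fin.last (d + 1)) ∧
            Fin.init z ∈ stairPath (d + 1) (Fin.init b) (Fin.init a)}

/-- A set is stair-convex if it contains the stair-path between any two of its points. -/
def IsStairConvex {d : ℕ} (S : Set (Fin d → ℝ)) : Prop :=
  ∀ a ∈ S, ∀ b ∈ S, stairPath d a b ⊆ S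

/-- The stair-convex hull: the intersection of all stair-convex sets containing `S`. -/
def stconv {d : ℕ} (S : Set (Fin d → ℝ)) : Set (Fin d → ℝ) :=
  ⋂₀ {T | IsStairConvex T ∧ S ⊆ T}

/-! ### The stretched grid and the stretched diagonal

The `i`-th axis of the grid is `x i 1 < x i 2 < ⋯ < x i n`; values `x i j` with `j` outside
`{1, …, n}` play no role. -/

/-- The growth constants: `K₁ = 2^d` and `Kᵢ = 2^d · x_{i-1,n}` for `i ≥ 2`. -/
def growth {d : ℕ} (n : ℕ) (x : Fin d → ℕ → ℝ) (i : Fin d) : ℝ :=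
  if (i : ℕ) = 0 then 2 ^ d
  else 2 ^ d * x ⟨(i : ℕ) - 1, lt_of_le_of_lt (Nat.sub_le _ _) i.isLt⟩ n

/-- `x` lists the coordinates of a `d`-dimensional stretched grid with `n` points on every axis:
`x_{i,1} = 1` and `Kᵢ · x_{i,j} ≤ x_{i,j+1}` for `1 ≤ j < n`. -/
structure IsStretchedGrid {d : ℕ} (n : ℕ) (x : Fin d → ℕ → ℝ) : Prop where
  first : ∀ i, x i 1 = 1
  step : ∀ i j, 1 ≤ j → j < n → growth n x i * x i j ≤ x i (j + 1)

/-- The stretched diagonal `D_s(n) = {(x_{1,j}, …, x_{d,j}) : j = 1, …, n}`. -/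
def stretchedDiagonal {d : ℕ} (n : ℕ) (x : Fin d → ℕ → ℝ) : Set (Fin d → ℝ) :=
  {z | ∃ j, 1 ≤ j ∧ j ≤ n ∧ ∀ i, z i = x i j}

/-- The point `y` of the bounding box of the stretched grid corresponds to the point `u` of the
unit cube: in every axis `i`, `y i` lies weakly between `x_{i,j}` and `x_{i,j+1}`,
where `j` is the integer part of `u i * n` (and inside the bounding box, if one of these two
does not exist). -/
def Corresponds {d : ℕ} (n : ℕ) (x : Fin d → ℕ → ℝ) (u y : Fin d → ℝ) : Prop :=
  ∀ i, (1 ≤ y i ∧ y i ≤ x i n) ∧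
    ∀ j : ℕ, 1 ≤ j → j ≤ n →
      ((j : ℝ) ≤ u i * n → x i j ≤ y i) ∧ (u i * n < (j : ℝ) → y i ≤ x i j)

/-! ### Counting stabbed simplices -/

/-- The number of `(d-1)`-dimensional stair-simplices spanned by `X ⊆ ℝ^d` (the stair-convex hulls
of the `d`-point subsets of `X`) that are met by the set `A`. -/
def stairStabCount {d : ℕ} (X A : Set (Fin d → ℝ)) : ℕ :=
  {Z : Finset (Fin d → ℝ) | (Z : Set (Fin d → ℝ)) ⊆ X ∧ Z.card = d ∧
    (A ∩ stconv (Z : Set (Fin d → ℝ))).Nonempty}.ncard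

/-- The number of `(d-1)`-dimensional simplices spanned by `X ⊆ ℝ^d` (the convex hulls
of the affinely independent `d`-point subsets of `X`) that are met by the set `A`. -/
def stabCount {d : ℕ} (X A : Set (Fin d → ℝ)) : ℕ :=
  {Z : Finset (Fin d → ℝ) | (Z : Set (Fin d → ℝ)) ⊆ X ∧ Z.card = d ∧
    AffineIndependent ℝ ((↑) : Z → (Fin d → ℝ)) ∧
    (A ∩ convexHull ℝ (Z : Set (Fin d → ℝ))).Nonempty}.ncard

/-- The stretched diagonals given by the grids `x n` yield the upper bound `c` for the
constant `c_{d,1}`: every line stabs at most `c n^d + o(n^d)` of the `(d-1)`-dimensional simplices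
spanned by the `n`-point stretched diagonal. -/
def YieldsUpperBound {d : ℕ} (x : ℕ → Fin d → ℕ → ℝ) (c : ℝ) : Prop :=
  ∃ e : ℕ → ℝ, e =o[atTop] (fun n : ℕ => (n : ℝ) ^ d) ∧
    ∀ (n : ℕ) (L : AffineSubspace ℝ (Fin d → ℝ)), Module.finrank ℝ L.direction = 1 →
      (stabCount (stretchedDiagonal n (x n)) (L : Set (Fin d → ℝ)) : ℝ) ≤ c * (n : ℝ) ^ d + e n

/-! ### The explicit stair-path -/

/-- `q = (1, 3/(d+2), 4/(d+2), …, (d+1)/(d+2))`. -/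
def pathQ (d : ℕ) : Fin d → ℝ := fun i =>
  if (i : ℕ) = 0 then 1 else ((i : ℝ) + 2) / ((d : ℝ) + 2)

/-- `p = (1/(d+2), 2/(d+2), …, (d-1)/(d+2), (d-1)/(d+2))`. -/
def pathP (d : ℕ) : Fin d → ℝ := fun i =>
  if (i : ℕ) + 1 = d then ((d : ℝ) - 1) / ((d : ℝ) + 2) else ((i : ℝ) + 1) / ((d : ℝ) + 2)

end StairConvex

end

/-! For large `n` the point `p'` lies strictly below `q'` in every coordinate, so `σ(q', p')` climbs
from `p'` to `q'` and raises the last coordinate first. It has one segment per direction `j`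
(numbered from 0); on it, coordinates before `j` are those of `p'` and later ones those of `q'`.

A point lies in a stair-convex hull iff the generating set has a point of each of the `d + 1` types
relative to it (`mem_stconv_iff`). Among `d` diagonal points some point must then serve two types.
Away from the boundedly many indices next to coordinates of `p'` and `q'`, these can only be the
types `j` and `j + 1` for the direction `j` of the segment. This confines the `k`-th vertex to an
interval of about `n / (d + 2)` indices, except that the `j`-th vertex has twice that room when `j`
is the first or the last direction. Different `j` give disjoint families, so the count is `(d + 2) *
(n / (d + 2)) ^ d` up to lower order; index sets touching the exceptional indices number only `O(n ^
(d - 1))`.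

For the straight line, keep the vertices a bounded clearance inside their intervals, which again
costs only `o(n ^ d)`. All relevant coordinates then differ by huge factors. In homogeneous
coordinates, "a positive combination of the vertices lies on the line" is a square linear system.
Scaling each unknown and each equation by its dominant term turns it into a small perturbation of a
fixed matrix with entries `0`, `1`, `-1`, whose solution is the all-ones vector. So a positive
solution exists, and injectivity of the system gives affine independence
(`exists_pos_solution_of_near`, `line_meets_simplex`). Applying a supposed upper bound to these
lines yields the last part. -/

namespace StairConvex

/-! ### Perturbed linear systems -/

/-- If `T` has an inverse of norm at most `3` and `A` is close to `T`, then `A` is injective, and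
the solution of `A u = b` is close to the vector `1` if `b` is close to `T 1`. -/
theorem exists_pos_solution_of_near {ι : Type*} [Fintype ι] [Nonempty ι]
    (A T : ι → ι → ℝ) (b : ι → ℝ) (N : ℝ) (hN : 12 * (Fintype.card ι : ℝ) ≤ N)
    (hT : ∀ v : ι → ℝ, ∀ ε : ℝ, (∀ m, |∑ r, T m r * v r| ≤ ε) → ∀ m, |v m| ≤ 3 * ε)
    (hA : ∀ m r, N * |A m r - T m r| ≤ 1) (hb : ∀ m, N * |b m - ∑ r, T m r| ≤ 1) :
    (∀ v : ι → ℝ, (∀ m, ∑ r, A m r * v r = 0) → v = 0) ∧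
      ∃ u : ι → ℝ, (∀ r, 0 < u r) ∧ ∀ m, ∑ r, A m r * u r = b m := by
  have hc : (1 : ℝ) ≤ Fintype.card ι := by exact_mod_cast Fintype.card_pos
  have hN0 : 0 < N := by linarith
  have hA' : ∀ m r, |A m r - T m r| ≤ 1 / N := fun m r => by
    rw [le_div_iff₀ hN0, mul_comm]; exact hA m r
  have hb' : ∀ m, |b m - ∑ r, T m r| ≤ 1 / N := fun m => by
    rw [le_div_iff₀ hN0, mul_comm]; exact hb m
  -- With 12 here, the perturbation has operator norm at most 1/12 in the maximum norm.
  have hcN : (Fintype.card ι : ℝ) * (1 / N) ≤ 1 / 12 := by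
    rw [mul_one_div, div_le_iff₀ hN0]; linarith
  have hpert : ∀ v : ι → ℝ, ∀ B, (∀ r, |v r| ≤ B) → ∀ m,
      |∑ r, (A m r - T m r) * v r| ≤ B / 12 := by
    intro v B hv m
    have hB : 0 ≤ B := (abs_nonneg _).trans (hv (Classical.arbitrary ι))
    calc |∑ r, (A m r - T m r) * v r| ≤ ∑ r, |(A m r - T m r) * v r| :=
          Finset.abs_sum_le_sum_abs _ _
      _ ≤ ∑ _r : ι, 1 / N * B := by
          refine Finset.sum_le_sum fun r _ => ?_
          rw [abs_mul]
          exact mul_le_mul (hA' m r) (hv r) (abs_nonneg _) (by positivity)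
      _ = (Fintype.card ι : ℝ) * (1 / N) * B := by
          rw [Finset.sum_const, nsmul_eq_mul, Finset.card_univ, mul_assoc]
      _ ≤ 1 / 12 * B := mul_le_mul_of_nonneg_right hcN hB
      _ = B / 12 := by ring
  have hbound : ∀ v : ι → ℝ, ∀ ε : ℝ, (∀ m, |∑ r, A m r * v r| ≤ ε) → ∀ m, |v m| ≤ 4 * ε := by
    intro v ε hv
    -- At the largest entry `B` of `|v|`, `B ≤ 3 * (ε + B / 12)`; absorbing `B / 4` on the left
    -- gives `B ≤ 4 * ε`.
    obtain ⟨r₀, hr₀⟩ := Finite.exists_max fun r => |v r|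
    have h1 : ∀ m, |∑ r, T m r * v r| ≤ ε + |v r₀| / 12 := by
      intro m
      have : ∑ r, T m r * v r = ∑ r, A m r * v r - ∑ r, (A m r - T m r) * v r := by
        rw [← Finset.sum_sub_distrib]
        exact Finset.sum_congr rfl fun r _ => by ring
      rw [this]
      exact (abs_sub _ _).trans (add_le_add (hv m) (hpert v _ hr₀ m))
    have h2 := hT v _ h1 r₀
    intro m
    have h3 : |v m| ≤ |v r₀| := hr₀ m
    linarith
  have hinj : ∀ v : ι → ℝ, (∀ m, ∑ r, A m r * v r = 0) → v = 0 := by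
    intro v hv
    funext m
    have := hbound v 0 (fun m => by rw [hv m, abs_zero]) m
    rw [mul_zero] at this
    exact abs_nonpos_iff.mp this
  refine ⟨hinj, ?_⟩
  let L : (ι → ℝ) →ₗ[ℝ] (ι → ℝ) := Matrix.mulVecLin (Matrix.of A)
  have hL : ∀ v m, L v m = ∑ r, A m r * v r := fun v m => by
    simp [L, Matrix.mulVec, dotProduct]
  have hLinj : Function.Injective L := by
    rw [← LinearMap.ker_eq_bot, LinearMap.ker_eq_bot']
    intro v hv
    exact hinj v fun m => by rw [← hL, hv]; rfl
  obtain ⟨u, hu⟩ := (LinearMap.injective_iff_surjective.mp hLinj) b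
  have hu' : ∀ m, ∑ r, A m r * u r = b m := fun m => by rw [← hL, hu]
  refine ⟨u, fun r => ?_, hu'⟩
  -- The all-ones vector has residual at most 1/6, so `u` is within 4/6 of it and hence positive.
  have h1 : ∀ m, |∑ r, A m r * (u r - 1)| ≤ 1 / 12 + 1 / 12 := by
    intro m
    have : ∑ r, A m r * (u r - 1) =
        (b m - ∑ r, T m r) - ∑ r, (A m r - T m r) * 1 := by
      rw [← hu' m, ← Finset.sum_sub_distrib, ← Finset.sum_sub_distrib]
      exact Finset.sum_congr rfl fun r _ => by ring
    rw [this]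
    refine (abs_sub _ _).trans (add_le_add ((hb' m).trans ?_)
      (hpert (fun _ => 1) 1 (fun _ => by simp) m))
    refine le_trans ?_ hcN
    have : 0 ≤ 1 / N := by positivity
    nlinarith
  have h2 := hbound (fun r => u r - 1) _ h1 r
  have h3 := (abs_le.mp h2).1
  linarith

/-- `d + 1` homogeneous coordinates of widely different orders of magnitude; `t m` bounds the
`m`-th one. The points `W r`, `r ≠ i`, are placed relative to `P` and `Q` as in a stair-simplex
whose stair-path from `P` to `Q` is met in its segment parallel to the `i`-th axis. Then the line
`P Q` meets the simplex spanned by the `W r`, and these are independent. -/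
theorem line_meets_simplex {d : ℕ} (j : Fin d) (i : Fin (d + 1)) (hi : i = j.succ)
    (W : Fin (d + 1) → Fin (d + 1) → ℝ) (P Q t : Fin (d + 1) → ℝ) (N : ℝ)
    (hN : 12 * ((d : ℝ) + 1) ≤ N) (ht : Monotone t) (ht0 : t 0 = 1)
    (hW1 : ∀ r m, 1 ≤ W r m) (hWt : ∀ r m, W r m ≤ t m)
    (hP1 : ∀ m, 1 ≤ P m) (hQ1 : ∀ m, 1 ≤ Q m)
    (hQt : ∀ m, Q m ≤ t m) (hPQ : ∀ m, m < i → |P m - Q m| ≤ t m)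
    (hP0 : P 0 ≤ W 0 0)
    (h1 : ∀ r m, r < m → m < i → ∀ l < m, N * t l ^ 2 * W r m ≤ P m)
    (h2 : ∀ r, r < i → ∀ l < r, N * t l ^ 2 * P r ≤ W r r)
    (h3 : ∀ l < i, N * t l ^ 2 * W j.castSucc i ≤ Q i)
    (h4 : ∀ r, i < r → ∀ l < r, N * t l ^ 2 * Q r ≤ W r r)
    (h5 : ∀ r, r < j.castSucc → ∀ l < i, N * t l ^ 2 * W r i ≤ W j.castSucc i)
    (h6 : ∀ m, i ≤ m → ∀ l < m, N * t l ^ 2 * P m ≤ Q m)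
    (h7 : ∀ r m, r < m → r ≠ i → i < m → ∀ l < m, N * t l ^ 2 * W r m ≤ Q m)
    (h8 : ∀ l < i, N * t l ^ 2 * P i ≤ W j.castSucc i) :
    (∀ v : Fin (d + 1) → ℝ, (∀ m, ∑ r, (if r = i then 0 else v r * W r m) = 0) →
      ∀ r, r ≠ i → v r = 0) ∧
    ∃ μ : Fin (d + 1) → ℝ, (∀ r, 0 < μ r) ∧
      ∀ m, ∑ r, (if r = i then 0 else μ r * W r m) = P m + μ i * (Q m - P m) := by
  have hji : j.castSucc < i := hi ▸ Fin.castSucc_lt_succ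
  have hlt : ∀ r, r < i → r ≤ j.castSucc := fun r hr => by
    rw [hi] at hr
    simpa [Fin.le_def, Fin.lt_def, Nat.lt_succ_iff] using hr
  have hi0 : (0 : Fin (d + 1)) < i := hi ▸ Fin.succ_pos j
  have hN1 : 1 ≤ N := by
    have : (0 : ℝ) ≤ d := Nat.cast_nonneg d
    linarith
  have ht1 : ∀ m, 1 ≤ t m := fun m => ht0 ▸ ht (Fin.zero_le m)
  have hWp : ∀ r m, 0 < W r m := fun r m => one_pos.trans_le (hW1 r m)
  have hPp : ∀ m, 0 < P m := fun m => one_pos.trans_le (hP1 m)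
  have hQp : ∀ m, 0 < Q m := fun m => one_pos.trans_le (hQ1 m)
  have hNt : ∀ l, 1 ≤ N * t l ^ 2 := fun l => by
    have := one_le_pow₀ (ht1 l) (n := 2)
    nlinarith
  have hPW : ∀ r, r < i → P r ≤ W r r := by
    intro r hr
    rcases (Fin.zero_le r).eq_or_lt with h | h
    · rw [← h]; exact hP0
    · exact (le_mul_of_one_le_left (hPp r).le (hNt 0)).trans (h2 r hr 0 h)
  -- The expected weights. For rows before `i`, vertex `r` alone should account for coordinate `r`
  -- of `P`, so its weight is `P r / W r r`.
  set α : Fin (d + 1) → ℝ := fun r => P r / W r r with hα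
  have hαp : ∀ r, 0 < α r := fun r => div_pos (hPp r) (hWp r r)
  have hα1 : ∀ r, r < i → α r ≤ 1 := fun r hr => (div_le_one (hWp r r)).mpr (hPW r hr)
  have hαW : ∀ r, α r * W r r = P r := fun r => div_mul_cancel₀ _ (hWp r r).ne'
  have hαN : ∀ r, r < i → ∀ l < r, N * t l ^ 2 * α r ≤ 1 := fun r hr l hl => by
    rw [hα, ← mul_div_assoc, div_le_one (hWp r r)]
    exact h2 r hr l hl
  set γ : Fin (d + 1) → ℝ := fun r => Q r / W r r with hγ
  have hγp : ∀ r, 0 < γ r := fun r => div_pos (hQp r) (hWp r r)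
  have hγW : ∀ r, γ r * W r r = Q r := fun r => div_mul_cancel₀ _ (hWp r r).ne'
  have hγN : ∀ r, i < r → ∀ l < r, N * t l ^ 2 * γ r ≤ 1 := fun r hr l hl => by
    rw [hγ, ← mul_div_assoc, div_le_one (hWp r r)]
    exact h4 r hr l hl
  have hγ1 : ∀ r, i < r → γ r ≤ 1 := fun r hr =>
    (le_mul_of_one_le_left (hγp r).le (hNt i)).trans (hγN r hr i hr)
  -- The expected parameter on the line. In coordinate `i` the vertex `j` dominates `P i` and is
  -- dominated by `Q i`, so `s * Q i` must balance its contribution. Later coordinates then look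
  -- like `s * Q m`, hence the weights `s * γ r`.
  set s : ℝ := α j.castSucc * W j.castSucc i / Q i with hs
  have hsp : 0 < s := div_pos (mul_pos (hαp _) (hWp _ _)) (hQp i)
  have hsQ : s * Q i = α j.castSucc * W j.castSucc i := div_mul_cancel₀ _ (hQp i).ne'
  have hsN : ∀ l < i, N * t l ^ 2 * s ≤ 1 := fun l hl => by
    rw [hs, ← mul_div_assoc, div_le_one (hQp i)]
    refine le_trans ?_ (h3 l hl)
    have := hα1 _ hji
    refine mul_le_mul_of_nonneg_left ?_ (zero_le_one.trans (hNt l))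
    exact mul_le_of_le_one_left (hWp _ _).le this
  have hs1 : s ≤ 1 := (le_mul_of_one_le_left hsp.le (hNt 0)).trans (hsN 0 hi0)
  have hαt : ∀ r, 1 ≤ α r * t r := fun r => by
    rw [hα, div_mul_eq_mul_div, le_div_iff₀ (hWp r r), one_mul]
    exact (hWt r r).trans (le_mul_of_one_le_left (zero_le_one.trans (ht1 r)) (hP1 r))
  -- `s` is tiny, but not below `t i ^ (-2)`. This is why the separation hypotheses carry the factor
  -- `t l ^ 2`.
  have hst : 1 ≤ s * t i ^ 2 := by
    have e1 : 1 ≤ s * Q i * t j.castSucc := by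
      rw [hsQ]
      have := hαt j.castSucc
      have := hW1 j.castSucc i
      nlinarith
    have e2 : s * Q i * t j.castSucc ≤ s * t i * t i :=
      mul_le_mul (mul_le_mul_of_nonneg_left (hQt i) hsp.le) (ht hji.le)
        (zero_le_one.trans (ht1 _)) (mul_nonneg hsp.le (zero_le_one.trans (ht1 _)))
    calc (1 : ℝ) ≤ _ := e1.trans e2
      _ = _ := by ring
  -- a quantity that is negligible against `Q m` is negligible against `s * Q m`
  have hsmall : ∀ m a, i < m → 0 ≤ a → N * t i ^ 2 * a ≤ Q m → N * a ≤ s * Q m := by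
    intro m a _ ha h
    calc N * a = N * a * 1 := (mul_one _).symm
      _ ≤ N * a * (s * t i ^ 2) := mul_le_mul_of_nonneg_left hst (by positivity)
      _ = s * (N * t i ^ 2 * a) := by ring
      _ ≤ s * Q m := mul_le_mul_of_nonneg_left h hsp.le
  have htsq : ∀ l, t l ≤ t l ^ 2 := fun l => by have := ht1 l; nlinarith
  -- The unknown parameter of the line takes the free row `i`: moving `μ i * (Q - P)` to the left
  -- gives it the column `P - Q`. Then `u₀` scales the unknowns and `D` the equations.
  set V : Fin (d + 1) → Fin (d + 1) → ℝ := fun r m => if r = i then P m - Q m else W r m with hV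
  set u₀ : Fin (d + 1) → ℝ := fun r => if r < i then α r else if r = i then s else s * γ r with hu₀
  set D : Fin (d + 1) → ℝ := fun m => if m < i then P m else s * Q m with hD
  -- The limit system. Below `i` each coordinate determines its own weight; coordinate `i` equates
  -- the weight of vertex `j` with the line parameter, and so does every later coordinate with its
  -- own vertex.
  set T : Fin (d + 1) → Fin (d + 1) → ℝ := fun m r =>
    if m < i then (if r = m then 1 else 0)
    else if m = i then (if r = j.castSucc then 1 else 0) - (if r = i then 1 else 0)
    else (if r = m then 1 else 0) - (if r = i then 1 else 0) with hTdef
  have hu₀p : ∀ r, 0 < u₀ r := by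
    intro r
    simp only [hu₀]
    split_ifs
    · exact hαp r
    · exact hsp
    · exact mul_pos hsp (hγp r)
  have hDp : ∀ m, 0 < D m := by
    intro m
    simp only [hD]
    split_ifs
    · exact hPp m
    · exact mul_pos hsp (hQp m)
  have hTsum : ∀ v : Fin (d + 1) → ℝ, ∀ m, ∑ r, T m r * v r =
      if m < i then v m else if m = i then v j.castSucc - v i else v m - v i := by
    intro v m
    simp only [hTdef]
    split_ifs <;> simp [sub_mul, Finset.sum_sub_distrib]
  have hdrop : ∀ l a, 0 ≤ a → N * a ≤ N * t l ^ 2 * a := fun l a ha => by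
    have h := one_le_pow₀ (ht1 l) (n := 2)
    exact mul_le_mul_of_nonneg_right (le_mul_of_one_le_right (by linarith) h) ha
  have hWneg : ∀ r m a, 0 ≤ a → N * t m ^ 2 * a ≤ 1 → N * (W r m * a) ≤ 1 := by
    intro r m a ha h
    refine le_trans ?_ h
    rw [mul_assoc]
    refine mul_le_mul_of_nonneg_left ?_ (by linarith)
    exact mul_le_mul_of_nonneg_right ((hWt r m).trans (htsq m)) ha
  have hentry : ∀ m r, N * |V r m * u₀ r - T m r * D m| ≤ D m := by
    intro m r
    have hdiag : ∀ m, i ≤ m → N * |(P m - Q m) * s + 1 * (s * Q m)| ≤ s * Q m := by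
      intro m hm
      have e : (P m - Q m) * s + 1 * (s * Q m) = s * P m := by ring
      rw [e, abs_of_pos (mul_pos hsp (hPp m))]
      calc N * (s * P m) = s * (N * P m) := by ring
        _ ≤ s * Q m := mul_le_mul_of_nonneg_left
          ((hdrop 0 _ (hPp m).le).trans (h6 m hm 0 (hi0.trans_le hm))) hsp.le
    rcases lt_trichotomy m i with hm | hm | hm
    · have hDm : D m = P m := if_pos hm
      have hTm : T m r = if r = m then 1 else 0 := if_pos hm
      rw [hDm, hTm]
      rcases lt_trichotomy r i with hr | hr | hr
      · have hVr : V r m = W r m := if_neg hr.ne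
        have hur : u₀ r = α r := if_pos hr
        rw [hVr, hur]
        rcases lt_trichotomy r m with hrm | hrm | hrm
        · rw [if_neg hrm.ne, zero_mul, sub_zero, abs_of_pos (mul_pos (hWp _ _) (hαp _))]
          refine le_trans ?_ ((hdrop r _ (hWp r m).le).trans (h1 r m hrm hm r hrm))
          exact mul_le_mul_of_nonneg_left
            (mul_le_of_le_one_right (hWp _ _).le (hα1 r hr)) (by linarith)
        · subst hrm
          rw [if_pos rfl, mul_comm, one_mul, mul_comm (W r r), hαW, sub_self, abs_zero, zero_mul]
          exact (hPp r).le
        · rw [if_neg hrm.ne', zero_mul, sub_zero, abs_of_pos (mul_pos (hWp _ _) (hαp _))]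
          exact (hWneg r m _ (hαp r).le (hαN r hr m hrm)).trans (hP1 m)
      · have hVr : V r m = P m - Q m := if_pos hr
        have hur : u₀ r = s := by simp [hu₀, hr]
        rw [hVr, hur, if_neg (hr ▸ hm.ne'), zero_mul, sub_zero, abs_mul, abs_of_pos hsp]
        refine le_trans ?_ ((hsN m hm).trans (hP1 m))
        rw [mul_assoc]
        refine mul_le_mul_of_nonneg_left ?_ (by linarith)
        exact mul_le_mul_of_nonneg_right ((hPQ m hm).trans (htsq m)) hsp.le
      · have hVr : V r m = W r m := if_neg hr.ne'
        have hur : u₀ r = s * γ r := by simp [hu₀, hr.not_gt, hr.ne']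
        have hsγ : 0 < s * γ r := mul_pos hsp (hγp r)
        rw [hVr, hur, if_neg (hm.trans hr).ne', zero_mul, sub_zero,
          abs_of_pos (mul_pos (hWp _ _) hsγ)]
        refine (hWneg r m _ hsγ.le ?_).trans (hP1 m)
        refine le_trans ?_ (hγN r hr m (hm.trans hr))
        exact mul_le_mul_of_nonneg_left (mul_le_of_le_one_left (hγp r).le hs1)
          (zero_le_one.trans (hNt m))
    · subst hm
      have hDm : D m = s * Q m := if_neg (lt_irrefl m)
      have hTm : T m r = (if r = j.castSucc then 1 else 0) - (if r = m then 1 else 0) := by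
        simp [hTdef]
      rw [hDm, hTm]
      rcases lt_trichotomy r m with hr | hr | hr
      · have hVr : V r m = W r m := if_neg hr.ne
        have hur : u₀ r = α r := if_pos hr
        rw [hVr, hur, if_neg hr.ne, sub_zero]
        rcases (hlt r hr).lt_or_eq with hrj | hrj
        · rw [if_neg hrj.ne, zero_mul, sub_zero, abs_of_pos (mul_pos (hWp _ _) (hαp _)), hsQ]
          have e1 := h5 r hrj _ hji
          have e2 := hαt j.castSucc
          calc N * (W r m * α r) ≤ N * W r m * 1 := by
                rw [mul_one]
                exact mul_le_mul_of_nonneg_left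
                  (mul_le_of_le_one_right (hWp _ _).le (hα1 r hr)) (by linarith)
            _ ≤ N * W r m * (α j.castSucc * t j.castSucc ^ 2) := by
                refine mul_le_mul_of_nonneg_left (e2.trans ?_)
                  (mul_nonneg (by linarith) (hWp _ _).le)
                exact mul_le_mul_of_nonneg_left (htsq _) (hαp _).le
            _ = α j.castSucc * (N * t j.castSucc ^ 2 * W r m) := by ring
            _ ≤ _ := mul_le_mul_of_nonneg_left e1 (hαp _).le
        · rw [if_pos hrj, one_mul, hsQ, hrj, mul_comm, mul_comm (W _ _), sub_self, abs_zero,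
            zero_mul]
          exact (mul_pos (hαp _) (hWp _ _)).le
      · have hVr : V r m = P m - Q m := if_pos hr
        have hur : u₀ r = s := by simp [hu₀, hr]
        rw [hVr, hur, if_neg (hr ▸ hji.ne'), if_pos hr, zero_sub, neg_mul, sub_neg_eq_add]
        exact hdiag m le_rfl
      · have hVr : V r m = W r m := if_neg hr.ne'
        have hur : u₀ r = s * γ r := by simp [hu₀, hr.not_gt, hr.ne']
        have hsγ : 0 < s * γ r := mul_pos hsp (hγp r)
        rw [hVr, hur, if_neg (hji.trans hr).ne', if_neg hr.ne', sub_zero, zero_mul, sub_zero,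
          abs_of_pos (mul_pos (hWp _ _) hsγ)]
        calc N * (W r m * (s * γ r)) = s * (N * (W r m * γ r)) := by ring
          _ ≤ s * 1 := mul_le_mul_of_nonneg_left
            (hWneg r m _ (hγp r).le (hγN r hr m hr)) hsp.le
          _ ≤ s * Q m := mul_le_mul_of_nonneg_left (hQ1 m) hsp.le
    · have hDm : D m = s * Q m := if_neg hm.not_gt
      have hTm : T m r = (if r = m then 1 else 0) - (if r = i then 1 else 0) := by
        simp [hTdef, hm.not_gt, hm.ne']
      rw [hDm, hTm]
      rcases lt_trichotomy r i with hr | hr | hr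
      · have hVr : V r m = W r m := if_neg hr.ne
        have hur : u₀ r = α r := if_pos hr
        rw [hVr, hur, if_neg (hr.trans hm).ne, if_neg hr.ne, sub_zero, zero_mul, sub_zero,
          abs_of_pos (mul_pos (hWp _ _) (hαp _))]
        refine le_trans ?_ (hsmall m (W r m) hm (hWp _ _).le
          (h7 r m (hr.trans hm) hr.ne hm i hm))
        exact mul_le_mul_of_nonneg_left
          (mul_le_of_le_one_right (hWp _ _).le (hα1 r hr)) (by linarith)
      · have hVr : V r m = P m - Q m := if_pos hr
        have hur : u₀ r = s := by simp [hu₀, hr]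
        rw [hVr, hur, if_neg (hr ▸ hm.ne), if_pos hr, zero_sub, neg_mul, sub_neg_eq_add]
        exact hdiag m hm.le
      · have hVr : V r m = W r m := if_neg hr.ne'
        have hur : u₀ r = s * γ r := by simp [hu₀, hr.not_gt, hr.ne']
        have hsγ : 0 < s * γ r := mul_pos hsp (hγp r)
        rw [hVr, hur, if_neg hr.ne', sub_zero]
        rcases lt_trichotomy r m with hrm | hrm | hrm
        · rw [if_neg hrm.ne, zero_mul, sub_zero, abs_of_pos (mul_pos (hWp _ _) hsγ)]
          calc N * (W r m * (s * γ r)) = s * (N * (W r m * γ r)) := by ring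
            _ ≤ s * (N * W r m) := mul_le_mul_of_nonneg_left (mul_le_mul_of_nonneg_left
                (mul_le_of_le_one_right (hWp _ _).le (hγ1 r hr)) (by linarith)) hsp.le
            _ ≤ s * Q m := mul_le_mul_of_nonneg_left
                ((hdrop i _ (hWp r m).le).trans (h7 r m hrm hr.ne' hm i hm)) hsp.le
        · subst hrm
          have e : W r r * (s * γ r) - 1 * (s * Q r) = 0 := by rw [← hγW r]; ring
          rw [if_pos rfl, e, abs_zero, mul_zero]
          exact (mul_pos hsp (hQp _)).le
        · rw [if_neg hrm.ne', zero_mul, sub_zero, abs_of_pos (mul_pos (hWp _ _) hsγ)]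
          calc N * (W r m * (s * γ r)) = s * (N * (W r m * γ r)) := by ring
            _ ≤ s * 1 := mul_le_mul_of_nonneg_left
              (hWneg r m _ (hγp r).le (hγN r hr m hrm)) hsp.le
            _ ≤ s * Q m := mul_le_mul_of_nonneg_left (hQ1 m) hsp.le
  have hdivD : ∀ m a, N * |a| ≤ D m → N * |a / D m| ≤ 1 := fun m a ha => by
    rw [abs_div, abs_of_pos (hDp m), ← mul_div_assoc, div_le_one (hDp m)]
    exact ha
  obtain ⟨hinj, u, hup, hu⟩ := exists_pos_solution_of_near
    (fun m r => V r m * u₀ r / D m) T (fun m => P m / D m) N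
    (by simpa using hN)
    -- Solving `T` in order loses one `ε` per stage: `ε` below `i`, `2 * ε` at `i`, `3 * ε` above.
    (fun v ε hv m => by
      have hε : 0 ≤ ε := (abs_nonneg _).trans (hv m)
      have hlow : ∀ m, m < i → |v m| ≤ ε := fun m hm => by
        have := hv m
        rwa [hTsum, if_pos hm] at this
      have hvi : |v i| ≤ 2 * ε := by
        have h := hv i
        rw [hTsum, if_neg (lt_irrefl i), if_pos rfl] at h
        have h' := hlow _ hji
        rw [abs_le] at *
        constructor <;> linarith
      rcases lt_trichotomy m i with hm | hm | hm
      · linarith [hlow m hm]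
      · rw [hm]; linarith
      · have h := hv m
        rw [hTsum, if_neg hm.not_gt, if_neg hm.ne'] at h
        rw [abs_le] at *
        constructor <;> linarith)
    (fun m r => by
      have e : V r m * u₀ r / D m - T m r = (V r m * u₀ r - T m r * D m) / D m := by
        rw [sub_div, mul_div_cancel_right₀ _ (hDp m).ne']
      rw [e]
      exact hdivD m _ (hentry m r))
    (fun m => by
      have hsum := hTsum (fun _ => 1) m
      simp only [mul_one] at hsum
      rw [hsum]
      rcases lt_trichotomy m i with hm | hm | hm
      · have hDm : D m = P m := if_pos hm
        rw [if_pos hm, hDm, div_self (hPp m).ne', sub_self, abs_zero, mul_zero]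
        exact zero_le_one
      · subst hm
        have hDm : D m = s * Q m := if_neg (lt_irrefl m)
        rw [if_neg (lt_irrefl m), if_pos rfl, sub_self, sub_zero]
        refine hdivD m _ ?_
        rw [abs_of_pos (hPp m), hDm, hsQ]
        have e1 := h8 _ hji
        have e2 := hαt j.castSucc
        calc N * P m = N * P m * 1 := (mul_one _).symm
          _ ≤ N * P m * (α j.castSucc * t j.castSucc ^ 2) := by
              refine mul_le_mul_of_nonneg_left (e2.trans ?_)
                (mul_nonneg (by linarith) (hPp _).le)
              exact mul_le_mul_of_nonneg_left (htsq _) (hαp _).le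
          _ = α j.castSucc * (N * t j.castSucc ^ 2 * P m) := by ring
          _ ≤ _ := mul_le_mul_of_nonneg_left e1 (hαp _).le
      · have hDm : D m = s * Q m := if_neg hm.not_gt
        rw [if_neg hm.not_gt, if_neg hm.ne', sub_self, sub_zero]
        refine hdivD m _ ?_
        rw [abs_of_pos (hPp m), hDm]
        exact hsmall m _ hm (hPp m).le (h6 m hm.le i hm))
  constructor
  · intro v hv r hr
    -- Setting the unknown at `i` to zero removes the column `P - Q`, so injectivity of the full
    -- system gives independence of the vertices.
    have h := congrFun (hinj (fun r => if r = i then 0 else v r / u₀ r) fun m => by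
      have : ∀ r, V r m * u₀ r / D m * (if r = i then 0 else v r / u₀ r) =
          (if r = i then 0 else v r * W r m) / D m := by
        intro r
        by_cases h : r = i
        · simp [h]
        · have hVr : V r m = W r m := if_neg h
          have := (hu₀p r).ne'
          rw [if_neg h, if_neg h, hVr]
          field_simp
      rw [Finset.sum_congr rfl fun r _ => this r, ← Finset.sum_div, hv m, zero_div]) r
    simp only [if_neg hr, Pi.zero_apply, div_eq_zero_iff, (hu₀p r).ne', or_false] at h
    exact h
  · refine ⟨fun r => u₀ r * u r, fun r => mul_pos (hu₀p r) (hup r), fun m => ?_⟩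
    have h : ∑ r, V r m * (u₀ r * u r) = P m := by
      have h := hu m
      have : ∀ r, V r m * u₀ r / D m * u r = V r m * (u₀ r * u r) / D m := fun r => by ring
      rw [Finset.sum_congr rfl fun r _ => this r, ← Finset.sum_div] at h
      exact (div_left_inj' (hDp m).ne').mp h
    have e : ∀ r, (if r = i then 0 else u₀ r * u r * W r m) =
        V r m * (u₀ r * u r) - if r = i then (P m - Q m) * (u₀ i * u i) else 0 := by
      intro r
      by_cases h : r = i
      · simp [h, hV]
      · simp [h, hV]; ring
    rw [Finset.sum_congr rfl fun r _ => e r, Finset.sum_sub_distrib, h]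
    simp
    ring

end StairConvex
namespace StairConvex

/-! ### Stair-convex hulls and types -/

/-- `y` has type `k` with respect to `x`: the `k`-th coordinate of `y` is at least that of `x`
(no condition if `k = 0`), and all later coordinates of `y` are at most those of `x`. -/
def HasType {d : ℕ} (x : Fin d → ℝ) (k : ℕ) (y : Fin d → ℝ) : Prop :=
  (∀ i : Fin d, (i : ℕ) + 1 = k → x i ≤ y i) ∧ ∀ i : Fin d, k ≤ (i : ℕ) → y i ≤ x i

theorem hasType_self {d : ℕ} (x : Fin d → ℝ) (k : ℕ) : HasType x k x :=
  ⟨fun _ _ => le_rfl, fun _ _ => le_rfl⟩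

theorem hasType_last_iff {d : ℕ} (x y : Fin (d + 1) → ℝ) :
    HasType x (d + 1) y ↔ x (Fin.last d) ≤ y (Fin.last d) := by
  constructor
  · intro h
    exact h.1 _ (by simp)
  · intro h
    refine ⟨fun i hi => ?_, fun i hi => ?_⟩
    · have : i = Fin.last d := by ext; simp; omega
      rw [this]; exact h
    · have := i.isLt
      omega

theorem hasType_iff_init {d k : ℕ} (hk : k ≤ d) (x y : Fin (d + 1) → ℝ) :
    HasType x k y ↔
      y (Fin.last d) ≤ x (Fin.last d) ∧ HasType (Fin.init x) k (Fin.init y) := by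
  constructor
  · intro h
    exact ⟨h.2 _ (by simpa using hk), fun i hi => h.1 i.castSucc (by simpa using hi),
      fun i hi => h.2 i.castSucc (by simpa using hi)⟩
  · rintro ⟨h1, h2, h3⟩
    refine ⟨fun i => ?_, fun i => ?_⟩
    · refine Fin.lastCases (fun hi => ?_) (fun i hi => ?_) i
      · simp at hi; omega
      · exact h2 i (by simpa using hi)
    · refine Fin.lastCases (fun hi => h1) (fun i hi => ?_) i
      exact h3 i (by simpa using hi)

/-- A vertical segment, described by coordinates. -/
theorem mem_segment_snoc_iff {d : ℕ} {a z : Fin (d + 1) → ℝ} {c : ℝ} (h : a (Fin.last d) ≤ c) :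
    z ∈ segment ℝ a (Fin.snoc (Fin.init a) c : Fin (d + 1) → ℝ) ↔
      Fin.init z = Fin.init a ∧ a (Fin.last d) ≤ z (Fin.last d) ∧ z (Fin.last d) ≤ c := by
  constructor
  · rintro ⟨s, t, hs, ht, hst, rfl⟩
    refine ⟨?_, ?_, ?_⟩
    · funext i
      simp only [Fin.init, Pi.add_apply, Pi.smul_apply, smul_eq_mul, Fin.snoc_castSucc]
      rw [← add_mul, hst, one_mul]
    · simp only [Pi.add_apply, Pi.smul_apply, smul_eq_mul, Fin.snoc_last]
      have hs' : s = 1 - t := by linarith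
      subst hs'
      nlinarith
    · simp only [Pi.add_apply, Pi.smul_apply, smul_eq_mul, Fin.snoc_last]
      have hs' : t = 1 - s := by linarith
      subst hs'
      nlinarith
  · rintro ⟨h1, h2, h3⟩
    have hz : z (Fin.last d) ∈ segment ℝ (a (Fin.last d)) c := by
      rw [segment_eq_Icc h]; exact ⟨h2, h3⟩
    obtain ⟨s, t, hs, ht, hst, he⟩ := hz
    refine ⟨s, t, hs, ht, hst, ?_⟩
    funext i
    refine Fin.lastCases ?_ (fun i => ?_) i
    · simpa using he
    · simp only [Pi.add_apply, Pi.smul_apply, smul_eq_mul, Fin.snoc_castSucc, Fin.init]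
      rw [← add_mul, hst, one_mul]
      exact (congrFun h1 i).symm

theorem mem_segment_one_iff {a b z : Fin 1 → ℝ} (h : a 0 ≤ b 0) :
    z ∈ segment ℝ a b ↔ a 0 ≤ z 0 ∧ z 0 ≤ b 0 := by
  have hb : b = (Fin.snoc (Fin.init a) (b 0) : Fin 1 → ℝ) := by
    funext i
    have : i = Fin.last 0 := Subsingleton.elim _ _
    rw [this, Fin.snoc_last]; rfl
  rw [hb]
  have := mem_segment_snoc_iff (a := a) (z := z) (c := b 0) h
  rw [this]
  simp only [Fin.last_zero, Fin.snoc]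
  constructor
  · rintro ⟨-, h1, h2⟩
    exact ⟨h1, by simpa using h2⟩
  · rintro ⟨h1, h2⟩
    exact ⟨Subsingleton.elim _ _, h1, by simpa using h2⟩

theorem stairPath_of_last_le {d : ℕ} {a b : Fin (d + 2) → ℝ}
    (h : a (Fin.last (d + 1)) ≤ b (Fin.last (d + 1))) (z : Fin (d + 2) → ℝ) :
    z ∈ stairPath (d + 2) a b ↔
      (Fin.init z = Fin.init a ∧ a (Fin.last (d + 1)) ≤ z (Fin.last (d + 1)) ∧
        z (Fin.last (d + 1)) ≤ b (Fin.last (d + 1))) ∨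
      (z (Fin.last (d + 1)) = b (Fin.last (d + 1)) ∧
        Fin.init z ∈ stairPath (d + 1) (Fin.init a) (Fin.init b)) := by
  rw [stairPath, if_pos h, Set.mem_union, mem_segment_snoc_iff h]
  rfl

/-- Strictness sends the two argument orders into different branches that agree literally. At equal
heights both orders take the first branch, and symmetry would need an induction. -/
theorem stairPath_of_last_lt {d : ℕ} {a b : Fin (d + 2) → ℝ}
    (h : a (Fin.last (d + 1)) < b (Fin.last (d + 1))) :
    stairPath (d + 2) b a = stairPath (d + 2) a b := by
  rw [stairPath, stairPath, if_pos h.le, if_neg (not_le.mpr h)]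

/-- Points without type `k` form a stair-convex set. -/
theorem not_hasType_of_mem_stairPath : ∀ {d k : ℕ}, k ≤ d → ∀ x a b : Fin d → ℝ,
    ¬ HasType x k a → ¬ HasType x k b → ∀ y ∈ stairPath d a b, ¬ HasType x k y
  | 0, k, hk, x, a, b => fun ha => by
      exfalso
      exact ha ⟨fun i => i.elim0, fun i => i.elim0⟩
  | 1, k, hk, x, a, b => by
      have key : ∀ a b : Fin 1 → ℝ, a 0 ≤ b 0 → ¬ HasType x k a → ¬ HasType x k b →
          ∀ y ∈ segment ℝ a b, ¬ HasType x k y := by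
        intro a b hab ha hb y hy
        rw [mem_segment_one_iff hab] at hy
        rcases Nat.lt_or_ge k 1 with hk1 | hk1
        · have : ∀ y : Fin 1 → ℝ, HasType x k y ↔ y 0 ≤ x 0 := by
            intro y
            rw [hasType_iff_init (by omega)]
            exact ⟨fun h => h.1, fun h => ⟨h, fun i => i.elim0, fun i => i.elim0⟩⟩
          rw [this] at *
          linarith
        · obtain rfl : k = 0 + 1 := by omega
          rw [hasType_last_iff] at *
          simp only [Fin.last_zero] at *
          linarith
      intro ha hb y hy
      rw [stairPath] at hy
      rcases le_total (a 0) (b 0) with h | h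
      · exact key a b h ha hb y hy
      · exact key b a h hb ha y (segment_symm ℝ a b ▸ hy)
  | d + 2, k, hk, x, a, b => by
      have key : ∀ a b : Fin (d + 2) → ℝ, a (Fin.last _) ≤ b (Fin.last _) →
          ¬ HasType x k a → ¬ HasType x k b →
          ∀ y ∈ stairPath (d + 2) a b, ¬ HasType x k y := by
        intro a b hab ha hb y hy
        rw [stairPath_of_last_le hab] at hy
        rcases Nat.lt_or_ge k (d + 2) with hk1 | hk1
        -- A point of type `k` on the vertical part would force the type on `a`, which is lower and
        -- has the same initial coordinates. On the horizontal part the height is that of `b`, so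
        -- both projections lack the type and the induction applies.
        · rw [hasType_iff_init (by omega)] at *
          rintro ⟨hy1, hy2⟩
          rcases hy with ⟨h1, h2, h3⟩ | ⟨h1, h2⟩
          · rw [h1] at hy2
            exact ha ⟨by linarith, hy2⟩
          · refine not_hasType_of_mem_stairPath (by omega) (Fin.init x) (Fin.init a) (Fin.init b)
              (fun h => ha ⟨by linarith, h⟩) (fun h => hb ⟨by linarith, h⟩) _ h2 hy2
        · obtain rfl : k = d + 2 := by omega
          rw [hasType_last_iff] at *
          rcases hy with ⟨h1, h2, h3⟩ | ⟨h1, h2⟩ <;> linarith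
      intro ha hb y hy
      rcases le_or_gt (a (Fin.last _)) (b (Fin.last _)) with h | h
      · exact key a b h ha hb y hy
      · exact key b a h.le hb ha y (stairPath_of_last_lt h ▸ hy)

/-- A stair-convex set that contains points of all types with respect to `x` contains `x`. -/
theorem IsStairConvex.mem_of_hasType : ∀ {d : ℕ}, 1 ≤ d → ∀ {T : Set (Fin d → ℝ)},
    IsStairConvex T → ∀ x : Fin d → ℝ, (∀ k ≤ d, ∃ y ∈ T, HasType x k y) → x ∈ T
  | 0, hd, _, _, _, _ => by omega
  | 1, _, T, hT, x, h => by
      obtain ⟨a, haT, ha⟩ := h 0 (by omega)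
      obtain ⟨b, hbT, hb⟩ := h 1 le_rfl
      have h1 : a 0 ≤ x 0 := ha.2 0 (by simp)
      have h2 : x 0 ≤ b 0 := hb.1 0 (by simp)
      refine hT a haT b hbT ?_
      rw [stairPath, mem_segment_one_iff (h1.trans h2)]
      exact ⟨h1, h2⟩
  | d + 2, _, T, hT, x, h => by
      let c := x (Fin.last (d + 1))
      -- The slice of `T` at the height of `x`. A point of lower type lies weakly below this height
      -- and one of top type weakly above, so the vertical start of their stair-path puts the
      -- projection of the former into the slice.
      let T' : Set (Fin (d + 1) → ℝ) := {w | (Fin.snoc w c : Fin (d + 2) → ℝ) ∈ T}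
      have hT' : IsStairConvex T' := by
        intro a ha b hb y hy
        refine hT _ ha _ hb ?_
        rw [stairPath_of_last_le (by simp)]
        right
        simpa using hy
      have hx : Fin.init x ∈ T' := by
        refine IsStairConvex.mem_of_hasType (by omega) hT' _ (fun k hk => ?_)
        obtain ⟨y, hyT, hy⟩ := h k (by omega)
        obtain ⟨z, hzT, hz⟩ := h (d + 2) le_rfl
        rw [hasType_iff_init hk] at hy
        rw [hasType_last_iff] at hz
        refine ⟨Fin.init y, hT y hyT z hzT ?_, hy.2⟩
        rw [stairPath_of_last_le (hy.1.trans hz)]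
        left
        simpa [c] using ⟨hy.1, hz⟩
      simpa [T', c] using hx

/-- A point lies in the stair-convex hull of `S` iff `S` contains points of all types with respect
to it. -/
theorem mem_stconv_iff {d : ℕ} (hd : 1 ≤ d) {S : Set (Fin d → ℝ)} {x : Fin d → ℝ} :
    x ∈ stconv S ↔ ∀ k ≤ d, ∃ y ∈ S, HasType x k y := by
  constructor
  · intro hx k hk
    by_contra! hcon
    exact hx {y | ¬ HasType x k y}
      ⟨fun a ha b hb y hy => not_hasType_of_mem_stairPath hk x a b ha hb y hy, hcon⟩
      (hasType_self x k)
  · rintro h T ⟨hT, hST⟩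
    refine hT.mem_of_hasType hd x (fun k hk => ?_)
    obtain ⟨y, hy, hy'⟩ := h k hk
    exact ⟨y, hST hy, hy'⟩

/-- The stair-path from `a` up to `b`, when `a ≤ b` coordinatewise: the last coordinate rises
first, then the last but one, and so on. -/
theorem mem_stairPath_iff_of_le : ∀ {d : ℕ}, 1 ≤ d → ∀ {a b : Fin d → ℝ}, (∀ i, a i ≤ b i) →
    ∀ y : Fin d → ℝ, y ∈ stairPath d a b ↔
      ∃ j, (∀ m, m < j → y m = a m) ∧ (a j ≤ y j ∧ y j ≤ b j) ∧ ∀ m, j < m → y m = b m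
  | 0, hd, _, _, _, _ => by omega
  | 1, _, a, b, hab, y => by
      rw [stairPath, mem_segment_one_iff (hab 0)]
      constructor
      · intro h
        exact ⟨0, fun m hm => by omega, h, fun m hm => by omega⟩
      · rintro ⟨j, -, h, -⟩
        obtain rfl : j = 0 := Subsingleton.elim _ _
        exact h
  | d + 2, _, a, b, hab, y => by
      rw [stairPath_of_last_le (hab _),
        mem_stairPath_iff_of_le (by omega) (a := Fin.init a) (b := Fin.init b)
          (fun i => hab i.castSucc)]
      constructor
      · rintro (⟨h1, h2⟩ | ⟨h1, j, h2, h3, h4⟩)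
        · refine ⟨Fin.last _, fun m hm => ?_, h2, fun m hm => ?_⟩
          · obtain ⟨m, rfl⟩ := Fin.eq_castSucc_of_ne_last hm.ne
            exact congrFun h1 m
          · exact absurd (Fin.le_last m) (not_le.mpr hm)
        · refine ⟨j.castSucc, fun m => ?_, h3, fun m => ?_⟩
          · refine Fin.lastCases (fun hm => ?_) (fun m hm => ?_) m
            · exact absurd (Fin.le_last j.castSucc) (not_le.mpr hm)
            · exact h2 m (by simpa using hm)
          · refine Fin.lastCases (fun hm => h1) (fun m hm => ?_) m
            exact h4 m (by simpa using hm)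
      · rintro ⟨j, h1, h2, h3⟩
        revert h1 h2 h3
        refine Fin.lastCases (fun h1 h2 h3 => ?_) (fun j h1 h2 h3 => ?_) j
        · left
          exact ⟨funext fun m => h1 m.castSucc (Fin.castSucc_lt_last m), h2⟩
        · right
          exact ⟨h3 _ (Fin.castSucc_lt_last j), j, fun m hm => h1 m.castSucc (by simpa using hm),
            h2, fun m hm => h3 m.castSucc (by simpa using hm)⟩

end StairConvex
namespace StairConvex

/-! ### Stretched grids -/

namespace IsStretchedGrid

variable {d n : ℕ} {x : Fin d → ℕ → ℝ}

theorem growth_eq_of_pos (i : Fin d) (hi : (i : ℕ) ≠ 0) :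
    growth n x i = 2 ^ d * x ⟨(i : ℕ) - 1, lt_of_le_of_lt (Nat.sub_le _ _) i.isLt⟩ n := if_neg hi

theorem one_le_of_growth (h : IsStretchedGrid n x) {i : Fin d} (hg : 1 ≤ growth n x i) :
    ∀ {j : ℕ}, 1 ≤ j → j ≤ n → 1 ≤ x i j := by
  intro j hj
  induction j, hj using Nat.le_induction with
  | base => intro _; exact (h.first i).ge
  | succ j hj ih =>
    intro hjn
    have h1 := ih (by omega)
    have h2 := h.step i j hj (by omega)
    nlinarith

/-- Induction over the axes: each growth constant contains the last coordinate of the previous axis,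
which is at least 1 once the growth there is. -/
theorem two_pow_le_growth (h : IsStretchedGrid n x) (hn : 1 ≤ n) (i : Fin d) :
    2 ^ d ≤ growth n x i := by
  obtain ⟨i, hi⟩ := i
  induction i with
  | zero => simp [growth]
  | succ i ih =>
    have h1 := ih (by omega)
    have h2 := h.one_le_of_growth ((one_le_pow₀ one_le_two).trans h1) hn le_rfl
    rw [growth_eq_of_pos _ (by simp)]
    exact le_mul_of_one_le_right (by positivity) h2

theorem one_le_growth (h : IsStretchedGrid n x) (hn : 1 ≤ n) (i : Fin d) :
    1 ≤ growth n x i :=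
  (one_le_pow₀ one_le_two).trans (h.two_pow_le_growth hn i)

theorem one_le (h : IsStretchedGrid n x) (i : Fin d) {j : ℕ} (hj : 1 ≤ j) (hjn : j ≤ n) :
    1 ≤ x i j :=
  h.one_le_of_growth (h.one_le_growth (hj.trans hjn) i) hj hjn

theorem growth_pow_mul_le (h : IsStretchedGrid n x) (i : Fin d) {j : ℕ} (hj : 1 ≤ j) :
    ∀ k, j + k ≤ n → growth n x i ^ k * x i j ≤ x i (j + k) := by
  intro k
  induction k with
  | zero => simp
  | succ k ih =>
    intro hk
    have h1 := ih (by omega)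
    have h2 := h.step i (j + k) (by omega) (by omega)
    have h3 := h.one_le_growth (by omega) i
    calc growth n x i ^ (k + 1) * x i j = growth n x i * (growth n x i ^ k * x i j) := by ring
      _ ≤ growth n x i * x i (j + k) := mul_le_mul_of_nonneg_left h1 (by linarith)
      _ ≤ _ := h2

theorem lt_of_lt (h : IsStretchedGrid n x) (i : Fin d) {j k : ℕ} (hj : 1 ≤ j) (hjk : j < k)
    (hk : k ≤ n) : x i j < x i k := by
  obtain ⟨l, rfl⟩ := Nat.exists_eq_add_of_lt hjk
  have h1 := h.growth_pow_mul_le i hj (l + 1) (by omega)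
  have h2 := h.one_le i hj (by omega)
  have hd : d ≠ 0 := by rintro rfl; exact i.elim0
  have h3 : 1 < growth n x i :=
    (one_lt_pow₀ one_lt_two hd).trans_le (h.two_pow_le_growth (by omega) i)
  have h4 : 1 < growth n x i ^ (l + 1) := one_lt_pow₀ h3 (by omega)
  rw [show j + l + 1 = j + (l + 1) by ring]
  nlinarith

theorem le_of_le (h : IsStretchedGrid n x) (i : Fin d) {j k : ℕ} (hj : 1 ≤ j) (hjk : j ≤ k)
    (hk : k ≤ n) : x i j ≤ x i k := by
  rcases hjk.eq_or_lt with rfl | hjk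
  · exact le_rfl
  · exact (h.lt_of_lt i hj hjk hk).le

end IsStretchedGrid

/-- `y` lies at position `c` on the `i`-th axis of the grid. -/
def IsAt {d : ℕ} (n : ℕ) (x : Fin d → ℕ → ℝ) (i : Fin d) (c y : ℝ) : Prop :=
  ∀ j : ℕ, 1 ≤ j → j ≤ n → ((j : ℝ) ≤ c → x i j ≤ y) ∧ (c < j → y ≤ x i j)

theorem IsStretchedGrid.isAt {d n : ℕ} {x : Fin d → ℕ → ℝ} (h : IsStretchedGrid n x) (i : Fin d)
    {j : ℕ} (hj : 1 ≤ j) (hjn : j ≤ n) : IsAt n x i j (x i j) := by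
  intro k hk hkn
  constructor
  · intro hkj
    exact h.le_of_le i hk (by exact_mod_cast hkj) hjn
  · intro hjk
    exact (h.lt_of_lt i hj (by exact_mod_cast hjk) hkn).le

/-- A gap of 5 in position leaves room, after rounding at both ends, for three full steps of the
grid. -/
theorem IsStretchedGrid.growth_pow_three_mul_le {d n : ℕ} {x : Fin d → ℕ → ℝ}
    (h : IsStretchedGrid n x) {i : Fin d} {c c' y y' : ℝ} (hy : IsAt n x i c y)
    (hy' : IsAt n x i c' y') (hc : 0 ≤ c) (hcc' : c + 5 ≤ c') (hc' : c' ≤ n) :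
    growth n x i ^ 3 * y ≤ y' := by
  have h1 := Nat.floor_le hc
  have h2 := Nat.lt_floor_add_one c
  set j := ⌊c⌋₊ with hj
  have hjn : j + 1 + 3 ≤ n := by
    have : ((j + 1 + 3 : ℕ) : ℝ) ≤ n := by push_cast; linarith
    exact_mod_cast this
  have h3 := (hy (j + 1) (by omega) (by omega)).2 (by push_cast; exact h2)
  have h4 := (hy' (j + 1 + 3) (by omega) hjn).1 (by push_cast; linarith)
  have h5 := h.growth_pow_mul_le i (j := j + 1) (by omega) 3 hjn
  have h6 := h.one_le_growth (by omega) i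
  exact (mul_le_mul_of_nonneg_left h3 (by positivity)).trans (h5.trans h4)

theorem exists_corresponds {d n : ℕ} {x : Fin d → ℕ → ℝ} (h : IsStretchedGrid n x) (hn : 1 ≤ n)
    {u : Fin d → ℝ} (hu0 : ∀ i, 0 ≤ u i) (hu1 : ∀ i, u i ≤ 1) : ∃ y, Corresponds n x u y := by
  have hle : ∀ i, ⌊u i * n⌋₊ ≤ n := fun i => by
    have : u i * n ≤ n := mul_le_of_le_one_left (Nat.cast_nonneg n) (hu1 i)
    exact Nat.floor_le_of_le this
  -- The floor may be 0, where the axis has no point; the box then starts at index 1.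
  refine ⟨fun i => x i (max 1 ⌊u i * n⌋₊), fun i => ⟨⟨?_, ?_⟩, fun j hj hjn => ⟨fun hc => ?_,
    fun hc => ?_⟩⟩⟩
  · exact h.one_le i (le_max_left _ _) (max_le hn (hle i))
  · exact h.le_of_le i (le_max_left _ _) (max_le hn (hle i)) le_rfl
  · exact h.le_of_le i hj ((Nat.le_floor hc).trans (le_max_right _ _)) (max_le hn (hle i))
  · refine h.le_of_le i (le_max_left _ _) (max_le hj ?_) hjn
    have hu : 0 ≤ u i * n := mul_nonneg (hu0 i) (Nat.cast_nonneg n)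
    exact ((Nat.floor_lt hu).mpr hc).le

/-- The `j`-th point of the diagonal of the grid. -/
def diagPoint {d : ℕ} (x : Fin d → ℕ → ℝ) (j : ℕ) : Fin d → ℝ := fun i => x i j

theorem IsStretchedGrid.diagPoint_injOn {d n : ℕ} {x : Fin d → ℕ → ℝ} (h : IsStretchedGrid n x)
    (hd : 1 ≤ d) : Set.InjOn (diagPoint x) (Set.Icc 1 n) := by
  intro j hj k hk hjk
  have hjk' : x ⟨0, hd⟩ j = x ⟨0, hd⟩ k := congrFun hjk _
  rcases lt_trichotomy j k with hlt | heq | hlt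
  · exact absurd hjk' (h.lt_of_lt _ hj.1 hlt hk.2).ne
  · exact heq
  · exact absurd hjk' (h.lt_of_lt _ hk.1 hlt hj.2).ne'

/-! ### The combinatorial families of stabbed simplices -/

/-- `(d + 2)` times the `k`-th coordinate of `pathP d`. -/
def numP (d k : ℕ) : ℕ := if k + 1 = d then d - 1 else k + 1

/-- `(d + 2)` times the `k`-th coordinate of `pathQ d`. -/
def numQ (d k : ℕ) : ℕ := if k = 0 then d + 2 else k + 2

/-- `(d + 2)` times the lower end of the range of the `k`-th vertex of a simplex met by the `j`-th
segment of the stair-path. -/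
def lowerEnd (d j k : ℕ) : ℕ :=
  if k < j then k else if k = j then numP d j else k + 2

/-- `(d + 2)` times the upper end of the range of the `k`-th vertex of a simplex met by the `j`-th
segment of the stair-path. -/
def upperEnd (j k : ℕ) : ℕ :=
  if k < j then k + 1 else if k = j then (if j = 0 then 3 else j + 2) else k + 3

theorem pathP_eq {d : ℕ} (hd : 1 ≤ d) (i : Fin d) (n : ℕ) :
    pathP d i * n = numP d i * ((n : ℝ) / (d + 2)) := by
  rw [pathP, numP]
  split_ifs
  · rw [Nat.cast_sub hd]; push_cast; ring
  · push_cast; ring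

theorem pathQ_eq {d : ℕ} (i : Fin d) (n : ℕ) :
    pathQ d i * n = numQ d i * ((n : ℝ) / (d + 2)) := by
  have : (d : ℝ) + 2 ≠ 0 := by positivity
  rw [pathQ, numQ]
  split_ifs
  · push_cast; field_simp
  · push_cast; ring

/-- Rows `0, …, d` stand for types, with row `i` free: vertex `k` occupies row `k` before the gap
and row `k + 1` after it. -/
theorem exists_index_of_ne {d : ℕ} {i r : Fin (d + 1)} (h : r ≠ i) :
    ∃ k : Fin d, i.succAbove k = r ∧
      ((r < i ∧ (k : ℕ) = r) ∨ (i < r ∧ (k : ℕ) + 1 = r)) := by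
  obtain ⟨k, rfl⟩ := Fin.exists_succAbove_eq h
  refine ⟨k, rfl, ?_⟩
  rcases lt_or_ge k.castSucc i with hk | hk
  · left
    rw [Fin.succAbove_of_castSucc_lt _ _ hk]
    exact ⟨hk, rfl⟩
  · right
    rw [Fin.succAbove_of_le_castSucc _ _ hk]
    exact ⟨hk.trans_lt Fin.castSucc_lt_succ, rfl⟩

theorem twelve_mul_le {d : ℕ} (hd : 3 ≤ d) : 12 * ((d : ℝ) + 1) ≤ (2 ^ d) ^ 3 := by
  have : 12 * (d + 1) ≤ (2 ^ d) ^ 3 := by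
    rw [← pow_mul, mul_comm d 3, pow_mul]
    norm_num
    induction d, hd using Nat.le_induction with
    | base => norm_num
    | succ k hk ih => rw [pow_succ]; omega
  exact_mod_cast this

/-! ### Straight lines meeting simplices of the diagonal -/

/-- The straight line through `q` and `p` meets every simplex whose vertices lie, with some
clearance, in the ranges of some segment of the stair-path, and such simplices are
non-degenerate. -/
theorem line_meets_diagonal_simplex {d n : ℕ} (hd : 3 ≤ d) {x : Fin d → ℕ → ℝ}
    (hx : IsStretchedGrid n x) {q p : Fin d → ℝ} (hq : Corresponds n x (pathQ d) q)
    (hp : Corresponds n x (pathP d) p) (hn : 5 * ((d : ℝ) + 2) ≤ n) (j : Fin d) (τ : Fin d → ℕ)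
    (hlo : ∀ k : Fin d, lowerEnd d j k * ((n : ℝ) / (d + 2)) + 5 ≤ τ k)
    (hhi : ∀ k : Fin d, τ k + 5 ≤ upperEnd j k * ((n : ℝ) / (d + 2))) :
    AffineIndependent ℝ (fun k => diagPoint x (τ k)) ∧
      ((line[ℝ, q, p] : Set (Fin d → ℝ)) ∩
        convexHull ℝ (Set.range fun k => diagPoint x (τ k))).Nonempty := by
  have hd2 : (0 : ℝ) < (d : ℝ) + 2 := by positivity
  set U : ℝ := (n : ℝ) / (d + 2) with hU
  have hU5 : 5 ≤ U := by rw [hU, le_div_iff₀ hd2]; exact hn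
  have hUn : ((d + 2 : ℕ) : ℝ) * U = n := by
    rw [hU]; push_cast; field_simp
  have hn2 : 2 ≤ n := by
    have : (2 : ℝ) ≤ n := by nlinarith
    exact_mod_cast this
  have hmono : ∀ {a b : ℕ}, a ≤ b → (a : ℝ) * U ≤ b * U := fun hab =>
    mul_le_mul_of_nonneg_right (by exact_mod_cast hab) (by linarith)
  have hpAt : ∀ m, IsAt n x m (numP d m * U) (p m) := fun m => by
    rw [hU, ← pathP_eq (by omega)]; exact (hp m).2
  have hqAt : ∀ m, IsAt n x m (numQ d m * U) (q m) := fun m => by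
    rw [hU, ← pathQ_eq]; exact (hq m).2
  set i : Fin (d + 1) := j.succ with hi
  have hiv : (i : ℕ) = j + 1 := by simp [hi]
  have hupper : ∀ k : Fin d, upperEnd j k ≤ d + 2 := by
    intro k
    have := k.isLt
    unfold upperEnd
    split_ifs <;> omega
  -- The index 1 in row `i` is a dummy, valid only in that it lies between 1 and `n`.
  set σ : Fin (d + 1) → ℕ := i.insertNth 1 τ with hσ
  have hσk : ∀ k, σ (i.succAbove k) = τ k := fun k => by simp [hσ]
  have hτn : ∀ k, 1 ≤ τ k ∧ τ k ≤ n := by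
    intro k
    have h1 := hlo k
    have h2 := hhi k
    have h3 := hmono (hupper k)
    have h4 : 0 ≤ (lowerEnd d j k : ℝ) * U := mul_nonneg (Nat.cast_nonneg _) (by linarith)
    rw [hUn] at h3
    constructor
    · have : (1 : ℝ) ≤ τ k := by linarith
      exact_mod_cast this
    · have : (τ k : ℝ) ≤ n := by linarith
      exact_mod_cast this
  have hσn : ∀ r, 1 ≤ σ r ∧ σ r ≤ n := by
    intro r
    by_cases h : r = i
    · rw [h, hσ, Fin.insertNth_apply_same]; omega
    · obtain ⟨k, rfl, -⟩ := exists_index_of_ne h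
      rw [hσk]
      exact hτn k
  have hσAt : ∀ m r, IsAt n x m (σ r) (x m (σ r)) := fun m r => hx.isAt m (hσn r).1 (hσn r).2
  -- the bounds on the vertices, in terms of row indices
  have hσlt : ∀ r, r < i →
      lowerEnd d j r * U + 5 ≤ σ r ∧ σ r + 5 ≤ upperEnd j r * U := by
    intro r hr
    obtain ⟨k, rfl, ⟨-, hk⟩ | ⟨h, -⟩⟩ := exists_index_of_ne hr.ne
    · rw [hσk, ← hk]
      exact ⟨hlo k, hhi k⟩
    · exact absurd h hr.not_gt
  have hσgt : ∀ r, i < r →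
      lowerEnd d j (r - 1) * U + 5 ≤ σ r ∧ σ r + 5 ≤ upperEnd j (r - 1) * U := by
    intro r hr
    obtain ⟨k, rfl, ⟨h, -⟩ | ⟨-, hk⟩⟩ := exists_index_of_ne hr.ne'
    · exact absurd h hr.not_gt
    · rw [hσk, ← hk, Nat.add_sub_cancel]
      exact ⟨hlo k, hhi k⟩
  -- The prepended homogeneous coordinate 1 also makes every growth constant `2 ^ d` times the
  -- preceding entry of `t`, including the first one.
  set t : Fin (d + 1) → ℝ := Fin.cons 1 fun m => x m n with ht
  set P : Fin (d + 1) → ℝ := Fin.cons 1 p with hP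
  set Q : Fin (d + 1) → ℝ := Fin.cons 1 q with hQ
  set W : Fin (d + 1) → Fin (d + 1) → ℝ := fun r => Fin.cons 1 fun m => x m (σ r) with hW
  have hgrowth : ∀ m : Fin d, growth n x m = 2 ^ d * t m.castSucc := by
    intro m
    rcases Nat.eq_zero_or_pos (m : ℕ) with h | h
    · have : m.castSucc = 0 := by ext; simpa using h
      rw [this, growth, if_pos h, ht, Fin.cons_zero, mul_one]
    · have hm : m.castSucc = (⟨(m : ℕ) - 1, by omega⟩ : Fin d).succ := by
        ext; simp; omega
      rw [IsStretchedGrid.growth_eq_of_pos _ h.ne', hm, ht, Fin.cons_succ]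
  have htm : Monotone t := by
    rw [Fin.monotone_iff_le_succ]
    intro m
    have h1 := hx.step m 1 le_rfl (by omega)
    rw [hx.first, mul_one, hgrowth] at h1
    have h2 : x m 2 ≤ t m.succ := by
      rw [ht, Fin.cons_succ]; exact hx.le_of_le m (by omega) hn2 le_rfl
    have h3 : 0 ≤ t m.castSucc := by
      have h4 := hx.one_le_growth (by omega : 1 ≤ n) m
      rw [hgrowth] at h4
      by_contra hcon
      have : (0 : ℝ) < 2 ^ d := by positivity
      nlinarith
    exact (le_mul_of_one_le_left h3 (one_le_pow₀ one_le_two)).trans (h1.trans h2)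
  have ht1 : ∀ m, 1 ≤ t m := fun m => by
    have := htm (Fin.zero_le m)
    rwa [ht, Fin.cons_zero] at this
  -- Position gaps become the separations wanted by `line_meets_simplex`, with `N = (2 ^ d) ^ 3`;
  -- what remains is to compare numerators over `d + 2`.
  have hfar : ∀ (m : Fin (d + 1)) (hm : m ≠ 0) (a b c c' : ℝ),
      IsAt n x (m.pred hm) c a → IsAt n x (m.pred hm) c' b → 0 ≤ a →
      0 ≤ c → c + 5 ≤ c' → c' ≤ n → ∀ l < m, (2 ^ d) ^ 3 * t l ^ 2 * a ≤ b := by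
    intro m hm a b c c' ha hb ha0 hc hcc' hc' l hl
    refine le_trans ?_ (hx.growth_pow_three_mul_le ha hb hc hcc' hc')
    refine mul_le_mul_of_nonneg_right ?_ ha0
    rw [hgrowth, mul_pow]
    refine mul_le_mul_of_nonneg_left ?_ (by positivity)
    have hl' : l ≤ (m.pred hm).castSucc := by
      rw [Fin.le_def, Fin.val_castSucc, Fin.val_pred]
      rw [Fin.lt_def] at hl
      omega
    calc t l ^ 2 ≤ t (m.pred hm).castSucc ^ 2 :=
          pow_le_pow_left₀ (zero_le_one.trans (ht1 l)) (htm hl') 2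
      _ ≤ _ := pow_le_pow_right₀ (ht1 _) (by norm_num)
  have hcons : ∀ (f : Fin d → ℝ) (m : Fin (d + 1)) (hm : m ≠ 0),
      (Fin.cons 1 f : Fin (d + 1) → ℝ) m = f (m.pred hm) := by
    intro f m hm
    conv_lhs => rw [← Fin.succ_pred m hm, Fin.cons_succ]
  have hWm : ∀ (r m : Fin (d + 1)) (hm : m ≠ 0), W r m = x (m.pred hm) (σ r) :=
    fun r m hm => hcons _ m hm
  have hPn : ∀ m : Fin d, (numP d m : ℝ) * U ≤ n := fun m => by
    rw [← hUn]; refine hmono ?_; unfold numP; split_ifs <;> omega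
  have hQn : ∀ m : Fin d, (numQ d m : ℝ) * U ≤ n := fun m => by
    rw [← hUn]; refine hmono ?_; unfold numQ; split_ifs <;> omega
  have hnn : ∀ a : ℕ, 0 ≤ (a : ℝ) * U := fun a => mul_nonneg (Nat.cast_nonneg _) (by linarith)
  have hσnn : ∀ r, (σ r : ℝ) ≤ n := fun r => by exact_mod_cast (hσn r).2
  have hbox : ∀ (f : Fin d → ℝ), (∀ m, 1 ≤ f m ∧ f m ≤ x m n) →
      ∀ m, 1 ≤ (Fin.cons 1 f : Fin (d + 1) → ℝ) m ∧ (Fin.cons 1 f : Fin (d + 1) → ℝ) m ≤ t m := by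
    intro f hf m
    refine Fin.cases ?_ (fun m => ?_) m
    · simp [ht]
    · simpa [ht] using hf m
  have hWbox : ∀ r m, 1 ≤ W r m ∧ W r m ≤ t m := fun r => hbox _ fun m =>
    ⟨hx.one_le m (hσn r).1 (hσn r).2, hx.le_of_le m (hσn r).1 (hσn r).2 le_rfl⟩
  have hPbox := hbox p fun m => (hp m).1
  have hQbox := hbox q fun m => (hq m).1
  have hji : j.castSucc < i := Fin.castSucc_lt_succ
  obtain ⟨hind, μ, hμ0, hμ⟩ := line_meets_simplex j i hi W P Q t ((2 ^ d) ^ 3) (twelve_mul_le hd)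
    htm (by simp [ht]) (fun r m => (hWbox r m).1) (fun r m => (hWbox r m).2)
    (fun m => (hPbox m).1) (fun m => (hQbox m).1) (fun m => (hQbox m).2)
    (fun m _ => by
      have h1 := hPbox m
      have h2 := hQbox m
      rw [abs_le]; constructor <;> linarith)
    (by simp [hP, hW])
    (by
      intro r m hrm hmi
      have hm : m ≠ 0 := ((Fin.zero_le r).trans_lt hrm).ne'
      have e := (hσlt r (hrm.trans hmi)).2
      rw [hP, hcons _ m hm, hWm _ m hm]
      refine hfar m hm _ _ _ _ (hσAt _ r) (hpAt _) (by
        have := hx.one_le (m.pred hm) (hσn r).1 (hσn r).2; linarith) (Nat.cast_nonneg _)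
        (e.trans (hmono ?_)) (hPn _)
      have : (m.pred hm : ℕ) = m - 1 := Fin.val_pred m hm
      rw [Fin.lt_def] at *
      unfold upperEnd numP
      split_ifs <;> omega)
    (by
      intro r hr l hl
      have hm : r ≠ 0 := ((Fin.zero_le l).trans_lt hl).ne'
      have e := (hσlt r hr).1
      rw [hP, hcons _ r hm, hWm _ r hm]
      refine hfar r hm _ _ _ _ (hpAt _) (hσAt _ r) (by linarith [(hp (r.pred hm)).1.1]) (hnn _)
        ((add_le_add_left (hmono ?_) 5).trans e) (hσnn _) l hl
      have : (r.pred hm : ℕ) = r - 1 := Fin.val_pred r hm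
      rw [Fin.lt_def] at *
      unfold lowerEnd numP
      split_ifs <;> omega)
    (by
      have e := (hσlt _ hji).2
      have hm : i ≠ 0 := Fin.succ_ne_zero j
      rw [hQ, hcons _ i hm, hWm _ i hm]
      refine hfar i hm _ _ _ _ (hσAt _ _) (hqAt _) (by
        have := hx.one_le (i.pred hm) (hσn j.castSucc).1 (hσn j.castSucc).2; linarith)
        (Nat.cast_nonneg _) (e.trans (hmono ?_)) (hQn _)
      have : (i.pred hm : ℕ) = i - 1 := Fin.val_pred i hm
      have : (j.castSucc : ℕ) = j := rfl
      unfold upperEnd numQ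
      split_ifs <;> omega)
    (by
      intro r hr
      have e := (hσgt r hr).1
      have hm : r ≠ 0 := ((Fin.zero_le i).trans_lt hr).ne'
      rw [hQ, hcons _ r hm, hWm _ r hm]
      refine hfar r hm _ _ _ _ (hqAt _) (hσAt _ r) (by linarith [(hq (r.pred hm)).1.1]) (hnn _)
        ((add_le_add_left (hmono ?_) 5).trans e) (hσnn _)
      have : (r.pred hm : ℕ) = r - 1 := Fin.val_pred r hm
      rw [Fin.lt_def] at *
      unfold lowerEnd numQ
      split_ifs <;> omega)
    (by
      intro r hr
      have e := (hσlt r (hr.trans hji)).2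
      have e' := (hσlt _ hji).1
      have hm : i ≠ 0 := Fin.succ_ne_zero j
      rw [hWm _ i hm, hWm _ i hm]
      refine hfar i hm _ _ _ _ (hσAt _ r) (hσAt _ _) (by
        have := hx.one_le (i.pred hm) (hσn r).1 (hσn r).2; linarith) (Nat.cast_nonneg _) ?_ (hσnn _)
      have : (upperEnd j r : ℝ) * U ≤ lowerEnd d j j.castSucc * U := by
        refine hmono ?_
        have : (j.castSucc : ℕ) = j := rfl
        rw [Fin.lt_def] at *
        unfold lowerEnd upperEnd numP
        split_ifs <;> omega
      linarith)
    (by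
      intro m hm'
      have hm : m ≠ 0 := ((Fin.succ_pos j).trans_le hm').ne'
      rw [hQ, hP, hcons _ m hm, hcons _ m hm]
      refine hfar m hm _ _ _ _ (hpAt _) (hqAt _) (by linarith [(hp (m.pred hm)).1.1]) (hnn _)
        ?_ (hQn _)
      -- No vertex is involved here: the gap of 5 is a whole unit `U` between the positions of `p`
      -- and `q`.
      have : ((numP d (m.pred hm) + 1 : ℕ) : ℝ) * U ≤ numQ d (m.pred hm) * U := by
        refine hmono ?_
        have := (m.pred hm).isLt
        unfold numP numQ
        split_ifs <;> omega
      push_cast at this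
      linarith)
    (by
      intro r m hrm hri him
      have hm : m ≠ 0 := ((Fin.zero_le r).trans_lt hrm).ne'
      have hmv : (m.pred hm : ℕ) = m - 1 := Fin.val_pred m hm
      rw [hQ, hcons _ m hm, hWm _ m hm]
      refine hfar m hm _ _ _ _ (hσAt _ r) (hqAt _) (by
        have := hx.one_le (m.pred hm) (hσn r).1 (hσn r).2; linarith) (Nat.cast_nonneg _)
        ?_ (hQn _)
      rcases lt_or_gt_of_ne hri with h | h
      · refine (hσlt r h).2.trans (hmono ?_)
        rw [Fin.lt_def] at *
        unfold upperEnd numQ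
        split_ifs <;> omega
      · refine (hσgt r h).2.trans (hmono ?_)
        rw [Fin.lt_def] at *
        unfold upperEnd numQ
        split_ifs <;> omega)
    (by
      have e := (hσlt _ hji).1
      have hm : i ≠ 0 := Fin.succ_ne_zero j
      rw [hP, hcons _ i hm, hWm _ i hm]
      refine hfar i hm _ _ _ _ (hpAt _) (hσAt _ _) (by linarith [(hp (i.pred hm)).1.1]) (hnn _)
        ((add_le_add_left (hmono ?_) 5).trans e) (hσnn _)
      have : (i.pred hm : ℕ) = i - 1 := Fin.val_pred i hm
      have : (j.castSucc : ℕ) = j := rfl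
      unfold lowerEnd numP
      split_ifs <;> omega)
  have hsum : ∀ f : Fin (d + 1) → ℝ, ∀ m, ∑ r, (if r = i then 0 else f r * W r m) =
      ∑ k, f (i.succAbove k) * (Fin.cons 1 (diagPoint x (τ k)) : Fin (d + 1) → ℝ) m := by
    intro f m
    rw [Fin.sum_univ_succAbove _ i, if_pos rfl, zero_add]
    refine Finset.sum_congr rfl fun k _ => ?_
    rw [if_neg (Fin.succAbove_ne i k), hW]
    simp only [hσk]
    rfl
  constructor
  · rw [affineIndependent_iff]
    intro s w hw0 hw k hk
    classical
    have h := hind (i.insertNth 0 fun k => if k ∈ s then w k else 0) (fun m => by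
      rw [hsum]
      simp only [Fin.insertNth_apply_succAbove, ite_mul, zero_mul, Finset.sum_ite_mem,
        Finset.univ_inter]
      refine Fin.cases ?_ (fun m => ?_) m
      · simpa using hw0
      · simpa [Finset.sum_apply] using congrFun hw m) (i.succAbove k) (Fin.succAbove_ne i k)
    simpa [hk] using h
  · have hy : ∑ k, μ (i.succAbove k) • diagPoint x (τ k) = AffineMap.lineMap p q (μ i) := by
      funext m
      have h := hμ m.succ
      rw [hsum] at h
      simp only [Fin.cons_succ, hP, hQ] at h
      simp only [Finset.sum_apply, Pi.smul_apply, smul_eq_mul, AffineMap.lineMap_apply,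
        vsub_eq_sub, vadd_eq_add, Pi.add_apply, Pi.sub_apply]
      rw [h]; ring
    refine ⟨∑ k, μ (i.succAbove k) • diagPoint x (τ k), ?_, ?_⟩
    · rw [hy, Set.pair_comm]
      exact AffineMap.lineMap_mem_affineSpan_pair _ _ _
    · refine (convex_convexHull ℝ _).sum_mem (fun k _ => (hμ0 _).le) ?_
        fun k _ => subset_convexHull ℝ _ ⟨k, rfl⟩
      -- As `P 0 = Q 0 = 1`, the homogeneous coordinate says that the weights sum to 1.
      have h := hμ 0
      rw [hsum] at h
      simpa [hP, hQ] using h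

end StairConvex
namespace StairConvex

/-! ### Index families and their disjointness -/

/-- The indices that may be the `k`-th vertex of a simplex met by the `j`-th segment of the
stair-path, with clearance `M` at both ends. -/
noncomputable def vertexRange (d M n j k : ℕ) : Finset ℕ :=
  Finset.Ioc (⌊(lowerEnd d j k : ℝ) * ((n : ℝ) / (d + 2))⌋₊ + M)
    (⌊(upperEnd j k : ℝ) * ((n : ℝ) / (d + 2))⌋₊ - M)

/-- The pairs of a segment of the stair-path and the indices of the vertices of a simplex met
by it. -/
noncomputable def stabFamily (d M n : ℕ) : Finset (Σ _ : Fin d, Fin d → ℕ) :=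
  Finset.univ.sigma fun j => Fintype.piFinset fun k : Fin d => vertexRange d M n j k

/-- The points of the diagonal with indices `τ k`. -/
noncomputable def vertexSet {d : ℕ} (x : Fin d → ℕ → ℝ) (τ : Fin d → ℕ) : Finset (Fin d → ℝ) :=
  by classical exact Finset.univ.image fun k => diagPoint x (τ k)

theorem coe_vertexSet {d : ℕ} (x : Fin d → ℕ → ℝ) (τ : Fin d → ℕ) :
    (vertexSet x τ : Set (Fin d → ℝ)) = Set.range fun k => diagPoint x (τ k) := by
  simp [vertexSet]

theorem mul_unit_le_mul_unit (d n : ℕ) {a b : ℕ} (h : a ≤ b) :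
    (a : ℝ) * ((n : ℝ) / (d + 2)) ≤ b * ((n : ℝ) / (d + 2)) :=
  mul_le_mul_of_nonneg_right (by exact_mod_cast h) (by positivity)

theorem mul_unit_le {d : ℕ} (n : ℕ) {a : ℕ} (h : a ≤ d + 2) :
    (a : ℝ) * ((n : ℝ) / (d + 2)) ≤ n := by
  refine (mul_unit_le_mul_unit d n h).trans (le_of_eq ?_)
  have : (d : ℝ) + 2 ≠ 0 := by positivity
  push_cast
  field_simp

theorem upperEnd_le {d j k : ℕ} (_ : j < d) (_ : k < d) : upperEnd j k ≤ d + 2 := by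
  unfold upperEnd
  split_ifs <;> omega

theorem upperEnd_le_lowerEnd {d j k l : ℕ} (hkl : k < l) : upperEnd j k ≤ lowerEnd d j l := by
  unfold upperEnd lowerEnd numP
  split_ifs <;> omega

theorem mem_vertexRange {d M n j k i : ℕ} (h : i ∈ vertexRange d M n j k) :
    (lowerEnd d j k : ℝ) * ((n : ℝ) / (d + 2)) + M < i ∧
      (i : ℝ) + M ≤ upperEnd j k * ((n : ℝ) / (d + 2)) := by
  rw [vertexRange, Finset.mem_Ioc] at h
  obtain ⟨h1, h2⟩ := h
  constructor
  · have h3 := Nat.lt_floor_add_one ((lowerEnd d j k : ℝ) * ((n : ℝ) / (d + 2)))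
    have h4 : ((⌊(lowerEnd d j k : ℝ) * ((n : ℝ) / (d + 2))⌋₊ + M + 1 : ℕ) : ℝ) ≤ i := by
      exact_mod_cast h1
    push_cast at h4
    linarith
  · have h3 := Nat.floor_le (a := (upperEnd j k : ℝ) * ((n : ℝ) / (d + 2))) (by positivity)
    have h4 : ((i + M : ℕ) : ℝ) ≤ (⌊(upperEnd j k : ℝ) * ((n : ℝ) / (d + 2))⌋₊ : ℕ) := by
      exact_mod_cast (by omega : i + M ≤ ⌊(upperEnd j k : ℝ) * ((n : ℝ) / (d + 2))⌋₊)
    push_cast at h4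
    linarith

theorem mem_vertexRange_zero {d n j k i : ℕ}
    (h1 : (lowerEnd d j k : ℝ) * ((n : ℝ) / (d + 2)) < i)
    (h2 : (i : ℝ) ≤ upperEnd j k * ((n : ℝ) / (d + 2))) : i ∈ vertexRange d 0 n j k := by
  rw [vertexRange, Finset.mem_Ioc, add_zero, Nat.sub_zero]
  exact ⟨(Nat.floor_lt (by positivity)).mpr h1, Nat.le_floor h2⟩

theorem mem_stabFamily {d M n : ℕ} {j : Fin d} {τ : Fin d → ℕ} :
    (⟨j, τ⟩ : Σ _ : Fin d, Fin d → ℕ) ∈ stabFamily d M n ↔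
      ∀ k : Fin d, τ k ∈ vertexRange d M n j k := by
  simp [stabFamily, Fintype.mem_piFinset]

theorem strictMono_of_mem_stabFamily {d M n : ℕ} {j : Fin d} {τ : Fin d → ℕ}
    (h : (⟨j, τ⟩ : Σ _ : Fin d, Fin d → ℕ) ∈ stabFamily d M n) : StrictMono τ := by
  intro k l hkl
  rw [mem_stabFamily] at h
  have h1 := (mem_vertexRange (h k)).2
  have h2 := (mem_vertexRange (h l)).1
  have h3 := mul_unit_le_mul_unit d n (upperEnd_le_lowerEnd (d := d) (j := j) hkl)
  have h4 : (0 : ℝ) ≤ M := Nat.cast_nonneg M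
  have : (τ k : ℝ) < τ l := by linarith
  exact_mod_cast this

theorem mem_Icc_of_mem_stabFamily {d M n : ℕ} {j : Fin d} {τ : Fin d → ℕ}
    (h : (⟨j, τ⟩ : Σ _ : Fin d, Fin d → ℕ) ∈ stabFamily d M n) (k : Fin d) :
    τ k ∈ Set.Icc 1 n := by
  rw [mem_stabFamily] at h
  have h1 := mem_vertexRange (h k)
  have h2 := mul_unit_le n (upperEnd_le j.isLt k.isLt)
  have h3 : (0 : ℝ) ≤ lowerEnd d j k * ((n : ℝ) / (d + 2)) := by positivity
  have h4 : (0 : ℝ) ≤ M := Nat.cast_nonneg M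
  constructor
  · have : (0 : ℝ) < τ k := by linarith
    exact_mod_cast this
  · have : (τ k : ℝ) ≤ n := by linarith
    exact_mod_cast this

/-- If `j < j'`, the `j`-th index exceeds `j + 1` units in the first family and is at most `j + 1`
units in the second. -/
theorem eq_of_mem_stabFamily {d M n : ℕ} {j j' : Fin d} {τ : Fin d → ℕ}
    (h : (⟨j, τ⟩ : Σ _ : Fin d, Fin d → ℕ) ∈ stabFamily d M n)
    (h' : (⟨j', τ⟩ : Σ _ : Fin d, Fin d → ℕ) ∈ stabFamily d M n) : j = j' := by
  have key : ∀ j j' : Fin d, (⟨j, τ⟩ : Σ _ : Fin d, Fin d → ℕ) ∈ stabFamily d M n →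
      (⟨j', τ⟩ : Σ _ : Fin d, Fin d → ℕ) ∈ stabFamily d M n → ¬ j < j' := by
    intro j j' h h' hlt
    rw [mem_stabFamily] at h h'
    have h1 := (mem_vertexRange (h j)).1
    have h2 := (mem_vertexRange (h' j)).2
    have h3 : upperEnd j' j ≤ lowerEnd d j j := by
      have := j'.isLt
      rw [Fin.lt_def] at hlt
      unfold upperEnd lowerEnd numP
      split_ifs <;> omega
    have h4 := mul_unit_le_mul_unit d n h3
    have h5 : (0 : ℝ) ≤ M := Nat.cast_nonneg M
    linarith
  exact le_antisymm (not_lt.mp (key _ _ h' h)) (not_lt.mp (key _ _ h h'))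

/-- Tuples in the family are increasing, so the vertex set determines the tuple, and the tuple
determines the segment. -/
theorem vertexSet_injOn {d M n : ℕ} (hd : 1 ≤ d) {x : Fin d → ℕ → ℝ} (hx : IsStretchedGrid n x) :
    Set.InjOn (fun s : Σ _ : Fin d, Fin d → ℕ => vertexSet x s.2) (stabFamily d M n) := by
  rintro ⟨j, τ⟩ h ⟨j', τ'⟩ h' heq
  have heq' := congrArg (fun Z : Finset (Fin d → ℝ) => (Z : Set (Fin d → ℝ))) heq
  simp only [coe_vertexSet] at heq'
  have h1 : ∀ f : Fin d → ℕ, Set.range (fun k => diagPoint x (f k)) = diagPoint x '' Set.range f :=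
    fun f => Set.range_comp (diagPoint x) f
  rw [h1, h1] at heq'
  have hrange := ((hx.diagPoint_injOn hd).image_eq_image_iff
    (Set.range_subset_iff.mpr (mem_Icc_of_mem_stabFamily h))
    (Set.range_subset_iff.mpr (mem_Icc_of_mem_stabFamily h'))).mp heq'
  obtain rfl : τ = τ' := (StrictMono.range_inj (strictMono_of_mem_stabFamily h)
    (strictMono_of_mem_stabFamily h')).mp hrange
  obtain rfl := eq_of_mem_stabFamily h h'
  rfl

theorem stretchedDiagonal_eq {d n : ℕ} (x : Fin d → ℕ → ℝ) :
    stretchedDiagonal n x = diagPoint x '' Set.Icc 1 n := by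
  ext z
  constructor
  · rintro ⟨j, h1, h2, h3⟩
    exact ⟨j, ⟨h1, h2⟩, (funext h3).symm⟩
  · rintro ⟨j, ⟨h1, h2⟩, rfl⟩
    exact ⟨j, h1, h2, fun _ => rfl⟩

theorem finite_stretchedDiagonal {d n : ℕ} (x : Fin d → ℕ → ℝ) :
    (stretchedDiagonal n x).Finite := by
  rw [stretchedDiagonal_eq]
  exact (Set.finite_Icc 1 n).image _

theorem finite_subsets {α : Type*} {X : Set α} (hX : X.Finite) (P : Finset α → Prop) :
    {Z : Finset α | (Z : Set α) ⊆ X ∧ P Z}.Finite := by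
  refine (hX.toFinset.powerset : Finset (Finset α)).finite_toSet.subset ?_
  rintro Z ⟨hZ, -⟩
  rw [Finset.mem_coe, Finset.mem_powerset]
  intro z hz
  exact hX.mem_toFinset.mpr (hZ hz)

/-- If all members of the family satisfy `P`, they bound the number of `d`-point subsets of the
diagonal that satisfy `P` from below. -/
theorem card_stabFamily_le {d M n : ℕ} (hd : 1 ≤ d) {x : Fin d → ℕ → ℝ}
    (hx : IsStretchedGrid n x) (P : Finset (Fin d → ℝ) → Prop)
    (hP : ∀ j τ, (⟨j, τ⟩ : Σ _ : Fin d, Fin d → ℕ) ∈ stabFamily d M n → P (vertexSet x τ)) :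
    (stabFamily d M n).card ≤
      {Z : Finset (Fin d → ℝ) | (Z : Set (Fin d → ℝ)) ⊆ stretchedDiagonal n x ∧ Z.card = d ∧
        P Z}.ncard := by
  have hfin := finite_subsets (finite_stretchedDiagonal (n := n) x) fun Z => Z.card = d ∧ P Z
  rw [← Set.ncard_coe_finset, ← (vertexSet_injOn hd hx).ncard_image]
  refine Set.ncard_le_ncard ?_ hfin
  rintro _ ⟨⟨j, τ⟩, h, rfl⟩
  have h : (⟨j, τ⟩ : Σ _ : Fin d, Fin d → ℕ) ∈ stabFamily d M n := h
  refine ⟨?_, ?_, hP j τ h⟩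
  · rw [coe_vertexSet, stretchedDiagonal_eq]
    rintro _ ⟨k, rfl⟩
    exact ⟨τ k, mem_Icc_of_mem_stabFamily h k, rfl⟩
  · classical
    change (vertexSet x τ).card = d
    rw [vertexSet, Finset.card_image_of_injective, Finset.card_univ, Fintype.card_fin]
    intro k l hkl
    exact (strictMono_of_mem_stabFamily h).injective (hx.diagPoint_injOn hd
      (mem_Icc_of_mem_stabFamily h k) (mem_Icc_of_mem_stabFamily h l) hkl)

/-! ### The size of the family -/

theorem tendsto_card_vertexRange (d M j k : ℕ) (h : lowerEnd d j k ≤ upperEnd j k) :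
    Tendsto (fun n : ℕ => ((vertexRange d M n j k).card : ℝ) / n) atTop
      (nhds (((upperEnd j k : ℝ) - lowerEnd d j k) / (d + 2))) := by
  have hfl : ∀ a : ℕ, Tendsto (fun n : ℕ => (⌊(a : ℝ) * ((n : ℝ) / (d + 2))⌋₊ : ℝ) / n) atTop
      (nhds ((a : ℝ) / (d + 2))) := by
    intro a
    have h := (tendsto_nat_floor_mul_div_atTop (R := ℝ) (a := (a : ℝ) / (d + 2))
      (by positivity)).comp tendsto_natCast_atTop_atTop
    refine h.congr fun n => ?_
    simp only [Function.comp]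
    rw [div_mul_eq_mul_div, mul_div_assoc]
  have hM : Tendsto (fun n : ℕ => 2 * (M : ℝ) / n) atTop (nhds 0) :=
    tendsto_const_div_atTop_nhds_zero_nat _
  have hlim := (((hfl (upperEnd j k)).sub (hfl (lowerEnd d j k))).sub hM).max
    (tendsto_const_nhds (x := (0 : ℝ)))
  have hval : max ((upperEnd j k : ℝ) / (d + 2) - (lowerEnd d j k : ℝ) / (d + 2) - 0) 0 =
      ((upperEnd j k : ℝ) - lowerEnd d j k) / (d + 2) := by
    have : (lowerEnd d j k : ℝ) ≤ upperEnd j k := by exact_mod_cast h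
    rw [sub_zero, ← sub_div, max_eq_left]
    exact div_nonneg (by linarith) (by positivity)
  rw [hval] at hlim
  refine hlim.congr fun n => ?_
  rw [vertexRange, Nat.card_Ioc]
  -- For small `n` the clearances may exceed the interval; truncated subtraction is then the
  -- positive part, which disappears in the limit.
  have hsub : ∀ a b : ℕ, ((a - M - (b + M) : ℕ) : ℝ) = max ((a : ℝ) - b - 2 * M) 0 := by
    intro a b
    rcases le_total (b + 2 * M) a with hab | hab
    · have e : a - M - (b + M) = a - (b + 2 * M) := by omega
      rw [e, Nat.cast_sub hab, max_eq_left]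
      · push_cast; ring
      · have : ((b + 2 * M : ℕ) : ℝ) ≤ a := by exact_mod_cast hab
        push_cast at this
        linarith
    · have e : a - M - (b + M) = 0 := by omega
      rw [e, Nat.cast_zero, max_eq_right]
      have : (a : ℝ) ≤ (b + 2 * M : ℕ) := by exact_mod_cast hab
      push_cast at this
      linarith
  rw [hsub, ← max_div_div_right (Nat.cast_nonneg n), zero_div, sub_div, sub_div]

/-- Every range is one unit long, except that the `j`-th is two units long when `j` is the first or
last direction. -/
theorem prod_ends {d : ℕ} (hd : 3 ≤ d) (j : Fin d) :
    ∏ k : Fin d, (((upperEnd j k : ℝ) - lowerEnd d j k) / (d + 2)) =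
      (1 + (if (j : ℕ) = 0 then 1 else 0) + (if (j : ℕ) + 1 = d then 1 else 0)) /
        ((d : ℝ) + 2) ^ d := by
  rw [Finset.prod_div_distrib, Finset.prod_const, Finset.card_univ, Fintype.card_fin,
    Finset.prod_eq_single j]
  · congr 1
    simp only [upperEnd, lowerEnd, numP, lt_irrefl, if_false, if_true]
    split_ifs with h1 h2 h2
    · omega
    · rw [h1]; norm_num
    · have : (d : ℝ) = j + 1 := by exact_mod_cast h2.symm
      rw [Nat.cast_sub (by omega), this]; push_cast; ring
    · push_cast; ring
  · intro k _ hkj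
    have hkj' : (k : ℕ) ≠ j := fun h => hkj (Fin.ext h)
    simp only [upperEnd, lowerEnd, if_neg hkj']
    split_ifs <;> push_cast <;> ring
  · intro h
    exact absurd (Finset.mem_univ j) h

/-- The `d` segments and the two doubled ranges add up to `d + 2`, cancelling one factor of the
denominator. -/
theorem sum_prod_ends {d : ℕ} (hd : 3 ≤ d) :
    ∑ j : Fin d, ∏ k : Fin d, (((upperEnd j k : ℝ) - lowerEnd d j k) / (d + 2)) =
      1 / ((d : ℝ) + 2) ^ (d - 1) := by
  rw [Finset.sum_congr rfl fun j _ => prod_ends hd j, ← Finset.sum_div, Finset.sum_add_distrib,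
    Finset.sum_add_distrib]
  have h0 : ∑ j : Fin d, (if (j : ℕ) = 0 then (1 : ℝ) else 0) = 1 := by
    rw [Finset.sum_eq_single (⟨0, by omega⟩ : Fin d)]
    · simp
    · intro j _ hj
      exact if_neg fun h => hj (Fin.ext h)
    · simp
  have h1 : ∑ j : Fin d, (if (j : ℕ) + 1 = d then (1 : ℝ) else 0) = 1 := by
    rw [Finset.sum_eq_single (⟨d - 1, by omega⟩ : Fin d)]
    · simp only; exact if_pos (by omega)
    · intro j _ hj
      refine if_neg fun h => hj (Fin.ext ?_)
      simp only
      omega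
    · simp
  rw [h0, h1]
  have hne : (d : ℝ) + 2 ≠ 0 := by positivity
  have hpow : ((d : ℝ) + 2) ^ d = ((d : ℝ) + 2) ^ (d - 1) * (d + 2) := by
    rw [← pow_succ]; congr 1; omega
  rw [hpow]
  simp only [Finset.sum_const, Finset.card_univ, Fintype.card_fin, nsmul_eq_mul, mul_one]
  field_simp
  ring

theorem tendsto_card_stabFamily {d : ℕ} (hd : 3 ≤ d) (M : ℕ) :
    Tendsto (fun n : ℕ => ((stabFamily d M n).card : ℝ) / (n : ℝ) ^ d) atTop
      (nhds (1 / ((d : ℝ) + 2) ^ (d - 1))) := by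
  rw [← sum_prod_ends hd]
  have hlim : Tendsto (fun n : ℕ => ∑ j : Fin d, ∏ k : Fin d,
      (((vertexRange d M n j k).card : ℝ) / n)) atTop
      (nhds (∑ j : Fin d, ∏ k : Fin d, (((upperEnd j k : ℝ) - lowerEnd d j k) / (d + 2)))) := by
    refine tendsto_finsetSum _ fun j _ => tendsto_finsetProd _ fun k _ =>
      tendsto_card_vertexRange d M j k ?_
    have := j.isLt
    unfold lowerEnd upperEnd numP
    split_ifs <;> omega
  refine hlim.congr fun n => ?_
  rw [stabFamily, Finset.card_sigma, Nat.cast_sum, Finset.sum_div]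
  refine Finset.sum_congr rfl fun j _ => ?_
  rw [Fintype.card_piFinset, Nat.cast_prod, Finset.prod_div_distrib, Finset.prod_const,
    Finset.card_univ, Fintype.card_fin]

end StairConvex
namespace StairConvex

/-! ### Stair-simplices met by the stair-path -/

section

variable {d n : ℕ} {x : Fin d → ℕ → ℝ} {q p : Fin d → ℝ}

theorem isAt_numP (hd : 1 ≤ d) (hp : Corresponds n x (pathP d) p) (m : Fin d) :
    IsAt n x m (numP d m * ((n : ℝ) / (d + 2))) (p m) := by
  rw [← pathP_eq hd]; exact (hp m).2

theorem isAt_numQ (hq : Corresponds n x (pathQ d) q) (m : Fin d) :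
    IsAt n x m (numQ d m * ((n : ℝ) / (d + 2))) (q m) := by
  rw [← pathQ_eq]; exact (hq m).2

theorem numP_le {k : ℕ} (hk : k < d) : numP d k ≤ d + 2 := by
  unfold numP; split_ifs <;> omega

theorem numQ_le {k : ℕ} (hk : k < d) : numQ d k ≤ d + 2 := by
  unfold numQ; split_ifs <;> omega

theorem numP_add_one_le {k : ℕ} (hk : k < d) : numP d k + 1 ≤ numQ d k := by
  unfold numP numQ; split_ifs <;> omega

theorem pathP_lt_pathQ (hd : 1 ≤ d) (hx : IsStretchedGrid n x)
    (hq : Corresponds n x (pathQ d) q) (hp : Corresponds n x (pathP d) p)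
    (hn : 5 * ((d : ℝ) + 2) ≤ n) (m : Fin d) : p m < q m := by
  have hd2 : (0 : ℝ) < (d : ℝ) + 2 := by positivity
  have hU5 : 5 ≤ (n : ℝ) / (d + 2) := by rw [le_div_iff₀ hd2]; exact hn
  have hn1 : 1 ≤ n := by
    have : (1 : ℝ) ≤ n := by nlinarith
    exact_mod_cast this
  have h1 := mul_unit_le_mul_unit d n (numP_add_one_le m.isLt)
  push_cast at h1
  have h := hx.growth_pow_three_mul_le (isAt_numP hd hp m) (isAt_numQ hq m) (by positivity)
    (by linarith) (mul_unit_le n (numQ_le m.isLt))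
  have hp1 := (hp m).1.1
  have hg : 1 < growth n x m :=
    (one_lt_pow₀ one_lt_two (by omega)).trans_le (hx.two_pow_le_growth hn1 m)
  have hg3 : 1 < growth n x m ^ 3 := one_lt_pow₀ hg (by norm_num)
  nlinarith

/-- The stair-path between the two points, described explicitly. -/
theorem mem_stairPath_iff (hd : 2 ≤ d) (hpq : ∀ m, p m < q m) (y : Fin d → ℝ) :
    y ∈ stairPath d q p ↔
      ∃ j, (∀ m, m < j → y m = p m) ∧ (p j ≤ y j ∧ y j ≤ q j) ∧ ∀ m, j < m → y m = q m := by
  obtain ⟨e, rfl⟩ : ∃ e, d = e + 2 := ⟨d - 2, by omega⟩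
  rw [stairPath_of_last_lt (hpq _)]
  exact mem_stairPath_iff_of_le (by omega) (fun m => (hpq m).le) y

/-- The common point lies on the `j`-th segment and shares its `j`-th coordinate with vertex `j`.
That vertex then has both types `j` and `j + 1`; every other vertex supplies one of the remaining
types. -/
theorem stairPath_meets_stconv (hd : 3 ≤ d) (hx : IsStretchedGrid n x)
    (hq : Corresponds n x (pathQ d) q) (hp : Corresponds n x (pathP d) p)
    (hn : 5 * ((d : ℝ) + 2) ≤ n) {M : ℕ} {j : Fin d} {τ : Fin d → ℕ}
    (h : (⟨j, τ⟩ : Σ _ : Fin d, Fin d → ℕ) ∈ stabFamily d M n) :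
    (stairPath d q p ∩ stconv (vertexSet x τ : Set (Fin d → ℝ))).Nonempty := by
  have hpq := pathP_lt_pathQ (by omega) hx hq hp hn
  have hτ := mem_Icc_of_mem_stabFamily h
  have hmono := strictMono_of_mem_stabFamily h
  rw [mem_stabFamily] at h
  have hM : (0 : ℝ) ≤ M := Nat.cast_nonneg M
  have hPle : ∀ m k : Fin d, numP d m ≤ lowerEnd d j k → p m ≤ x m (τ k) := by
    intro m k hmk
    have h1 := (mem_vertexRange (h k)).1
    have h2 := mul_unit_le_mul_unit d n hmk
    exact (isAt_numP (by omega) hp m _ (hτ k).1 (hτ k).2).2 (by linarith)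
  have hQle : ∀ m k : Fin d, numQ d m ≤ lowerEnd d j k → q m ≤ x m (τ k) := by
    intro m k hmk
    have h1 := (mem_vertexRange (h k)).1
    have h2 := mul_unit_le_mul_unit d n hmk
    exact (isAt_numQ hq m _ (hτ k).1 (hτ k).2).2 (by linarith)
  have hlePx : ∀ m k : Fin d, upperEnd j k ≤ numP d m → x m (τ k) ≤ p m := by
    intro m k hmk
    have h1 := (mem_vertexRange (h k)).2
    have h2 := mul_unit_le_mul_unit d n hmk
    exact (isAt_numP (by omega) hp m _ (hτ k).1 (hτ k).2).1 (by linarith)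
  have hleQx : ∀ m k : Fin d, upperEnd j k ≤ numQ d m → x m (τ k) ≤ q m := by
    intro m k hmk
    have h1 := (mem_vertexRange (h k)).2
    have h2 := mul_unit_le_mul_unit d n hmk
    exact (isAt_numQ hq m _ (hτ k).1 (hτ k).2).1 (by linarith)
  have hjd := j.isLt
  set y : Fin d → ℝ := fun m => if m < j then p m else if m = j then x j (τ j) else q m with hy
  have hyp : ∀ m, m < j → y m = p m := fun m hm => if_pos hm
  have hyj : y j = x j (τ j) := by simp [hy]
  have hyq : ∀ m, j < m → y m = q m := fun m hm => by simp [hy, hm.not_gt, hm.ne']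
  refine ⟨y, ?_, ?_⟩
  · rw [mem_stairPath_iff (by omega) hpq]
    refine ⟨j, hyp, ?_, hyq⟩
    rw [hyj]
    refine ⟨hPle j j ?_, hleQx j j ?_⟩
    · simp [lowerEnd]
    · unfold upperEnd numQ; split_ifs <;> omega
  · rw [mem_stconv_iff (by omega), coe_vertexSet]
    intro k hk
    rcases Nat.lt_or_ge (j : ℕ) k with hjk | hjk
    · set l : Fin d := ⟨k - 1, by omega⟩ with hl
      have hlv : (l : ℕ) = k - 1 := rfl
      refine ⟨_, ⟨l, rfl⟩, fun i hi => ?_, fun i hi => ?_⟩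
      · obtain rfl : i = l := Fin.ext (by omega)
        rcases (show j ≤ l from Fin.le_def.mpr (by omega)).eq_or_lt with hjl | hjl
        · rw [← hjl, hyj]; exact le_rfl
        · rw [hyq _ hjl]
          refine hQle l l ?_
          rw [Fin.lt_def] at hjl
          unfold lowerEnd numQ; split_ifs <;> omega
      · rw [hyq i (Fin.lt_def.mpr (by omega))]
        refine hleQx i l ?_
        unfold upperEnd numQ; split_ifs <;> omega
    · set l : Fin d := ⟨k, by omega⟩ with hl
      have hlv : (l : ℕ) = k := rfl
      refine ⟨_, ⟨l, rfl⟩, fun i hi => ?_, fun i hi => ?_⟩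
      · rw [hyp i (Fin.lt_def.mpr (by omega))]
        refine hPle i l ?_
        unfold lowerEnd numP; split_ifs <;> omega
      · rcases lt_trichotomy i j with hij | hij | hij
        · rw [hyp i hij]
          refine hlePx i l ?_
          rw [Fin.lt_def] at hij
          unfold upperEnd numP; split_ifs <;> omega
        · rw [hij, hyj]
          refine hx.le_of_le j (hτ l).1 (hmono.monotone ?_) (hτ j).2
          exact Fin.le_def.mpr (by omega)
        · rw [hyq i hij]
          refine hleQx i l ?_
          rw [Fin.lt_def] at hij
          unfold upperEnd numQ; split_ifs <;> omega

/-! ### Upper bound for the stair-path: exceptional indices -/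

/-- The indices next to the coordinates of the end points of the stair-path. -/
noncomputable def boundaryIndices (d n : ℕ) : Finset ℕ :=
  Finset.univ.biUnion fun m : Fin d =>
    {⌊(numP d m : ℝ) * ((n : ℝ) / (d + 2))⌋₊, ⌊(numP d m : ℝ) * ((n : ℝ) / (d + 2))⌋₊ + 1,
      ⌊(numQ d m : ℝ) * ((n : ℝ) / (d + 2))⌋₊, ⌊(numQ d m : ℝ) * ((n : ℝ) / (d + 2))⌋₊ + 1}

theorem card_boundaryIndices_le (d n : ℕ) : (boundaryIndices d n).card ≤ 4 * d := by
  refine Finset.card_biUnion_le.trans ?_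
  refine (Finset.sum_le_card_nsmul _ _ 4 fun m _ => Finset.card_le_four).trans ?_
  simp [mul_comm]

/-- A corresponding coordinate is known only to lie between two neighbouring grid values. Comparing
it with any other grid value recovers the comparison of positions. -/
theorem IsStretchedGrid.le_iff_of_isAt (hx : IsStretchedGrid n x) {m : Fin d} {c y : ℝ}
    (hy : IsAt n x m c y) (hc : 0 ≤ c) (hcn : c ≤ n) {i : ℕ} (hi : 1 ≤ i) (hin : i ≤ n)
    (h1 : i ≠ ⌊c⌋₊) (h2 : i ≠ ⌊c⌋₊ + 1) :
    (x m i ≤ y → (i : ℝ) ≤ c) ∧ (y ≤ x m i → c < i) := by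
  have h3 := Nat.floor_le hc
  have h4 := Nat.lt_floor_add_one c
  constructor
  · intro h
    by_contra! hcon
    have h5 : ⌊c⌋₊ + 1 < i := by
      have := (Nat.floor_lt hc).mpr hcon
      omega
    have h6 := (hy (⌊c⌋₊ + 1) (by omega) (by omega)).2 (by push_cast; exact h4)
    have h7 := hx.lt_of_lt m (by omega) h5 hin
    linarith
  · intro h
    by_contra! hcon
    have h5 : i < ⌊c⌋₊ := by
      have := Nat.le_floor hcon
      omega
    have h6 : ⌊c⌋₊ ≤ n := Nat.floor_le_of_le hcn
    have h7 := (hy ⌊c⌋₊ (by omega) h6).1 h3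
    have h8 := hx.lt_of_lt m hi h5 h6
    linarith

/-- A stair-simplex that is met by the stair-path belongs to the family, unless one of its
vertices is next to a coordinate of an end point. -/
theorem exists_mem_stabFamily_of_meets (hd : 3 ≤ d) (hx : IsStretchedGrid n x)
    (hq : Corresponds n x (pathQ d) q) (hp : Corresponds n x (pathP d) p)
    (hn : 5 * ((d : ℝ) + 2) ≤ n) {J : Finset ℕ} (hJ : J ⊆ Finset.Icc 1 n) (hJd : J.card = d)
    (hJb : Disjoint J (boundaryIndices d n))
    (h : (stairPath d q p ∩ stconv (diagPoint x '' J)).Nonempty) :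
    ∃ j τ, (⟨j, τ⟩ : Σ _ : Fin d, Fin d → ℕ) ∈ stabFamily d 0 n ∧ Finset.univ.image τ = J := by
  have hJn : ∀ i ∈ J, 1 ≤ i ∧ i ≤ n := fun i hi => Finset.mem_Icc.mp (hJ hi)
  have hP : ∀ (m : Fin d), ∀ i ∈ J, (x m i ≤ p m → (i : ℝ) ≤ numP d m * ((n : ℝ) / (d + 2))) ∧
      (p m ≤ x m i → numP d m * ((n : ℝ) / (d + 2)) < i) := by
    intro m i hi
    have hb := Finset.disjoint_left.mp hJb hi
    simp only [boundaryIndices, Finset.mem_biUnion, Finset.mem_univ, true_and, Finset.mem_insert,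
      Finset.mem_singleton, not_exists, not_or] at hb
    exact hx.le_iff_of_isAt (isAt_numP (by omega) hp m) (by positivity)
      (mul_unit_le n (numP_le m.isLt)) (hJn i hi).1 (hJn i hi).2 (hb m).1 (hb m).2.1
  have hQ : ∀ (m : Fin d), ∀ i ∈ J, (x m i ≤ q m → (i : ℝ) ≤ numQ d m * ((n : ℝ) / (d + 2))) ∧
      (q m ≤ x m i → numQ d m * ((n : ℝ) / (d + 2)) < i) := by
    intro m i hi
    have hb := Finset.disjoint_left.mp hJb hi
    simp only [boundaryIndices, Finset.mem_biUnion, Finset.mem_univ, true_and, Finset.mem_insert,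
      Finset.mem_singleton, not_exists, not_or] at hb
    exact hx.le_iff_of_isAt (isAt_numQ hq m) (by positivity)
      (mul_unit_le n (numQ_le m.isLt)) (hJn i hi).1 (hJn i hi).2 (hb m).2.2.1 (hb m).2.2.2
  obtain ⟨y, hy1, hy2⟩ := h
  rw [mem_stairPath_iff (by omega) (pathP_lt_pathQ (by omega) hx hq hp hn)] at hy1
  obtain ⟨j, hyp, ⟨hyj1, hyj2⟩, hyq⟩ := hy1
  rw [mem_stconv_iff (by omega)] at hy2
  have hchoose : ∀ k : Fin (d + 1), ∃ i ∈ J, HasType y k (diagPoint x i) := by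
    intro k
    obtain ⟨_, ⟨i, hi, rfl⟩, hty⟩ := hy2 k (Nat.lt_succ_iff.mp k.isLt)
    exact ⟨i, hi, hty⟩
  choose f hfJ hf using hchoose
  have hjd := j.isLt
  -- two types of the same vertex are consecutive, around the direction of the segment
  have hdouble : ∀ a b : Fin (d + 1), a < b → f a = f b → a = j.castSucc ∧ b = j.succ := by
    intro a b hab hfab
    have hab' := Fin.lt_def.mp hab
    set l : Fin d := ⟨(b : ℕ) - 1, by omega⟩ with hl
    have hlv : (l : ℕ) = b - 1 := rfl
    have e1 : y l ≤ x l (f a) := by rw [hfab]; exact (hf b).1 l (by omega)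
    have e2 : x l (f a) ≤ y l := (hf a).2 l (by omega)
    -- The shared vertex agrees with `y` in coordinate `l`. If `l ≠ j` this is a coordinate of `p`
    -- or `q`, which the exclusion of boundary indices forbids.
    have hlj : l = j := by
      rcases lt_trichotomy l j with hlj | hlj | hlj
      · rw [hyp l hlj] at e1 e2
        have := (hP l _ (hfJ a)).1 e2
        have := (hP l _ (hfJ a)).2 e1
        linarith
      · exact hlj
      · rw [hyq l hlj] at e1 e2
        have := (hQ l _ (hfJ a)).1 e2
        have := (hQ l _ (hfJ a)).2 e1
        linarith
    have hbj : b = j.succ := Fin.ext (by rw [Fin.val_succ, ← hlj]; omega)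
    refine ⟨?_, hbj⟩
    rw [hlj] at e1
    by_contra hne
    have hbv : (b : ℕ) = j + 1 := by rw [hbj, Fin.val_succ]
    have haj : (a : ℕ) < j := by
      have : (a : ℕ) ≠ j := fun h => hne (Fin.ext h)
      omega
    -- If `a < j`, the vertex would lie strictly beyond the position of `p j` but not beyond that of
    -- the preceding coordinate of `p`. The positions of `p` are weakly increasing, which suffices.
    have e3 := (hP j _ (hfJ a)).2 (hyj1.trans e1)
    set m : Fin d := ⟨(j : ℕ) - 1, by omega⟩ with hm
    have hmv : (m : ℕ) = j - 1 := rfl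
    have e4 : x m (f a) ≤ y m := (hf a).2 m (by omega)
    rw [hyp m (Fin.lt_def.mpr (by omega))] at e4
    have e5 := (hP m _ (hfJ a)).1 e4
    have e6 := mul_unit_le_mul_unit d n (show numP d m ≤ numP d j by
      unfold numP; split_ifs <;> omega)
    linarith
  -- Pigeonhole: `d + 1` types, `d` points.
  have hfj : f j.castSucc = f j.succ := by
    obtain ⟨a, -, b, -, hab, hfab⟩ := Finset.exists_ne_map_eq_of_card_lt_of_maps_to
      (s := (Finset.univ : Finset (Fin (d + 1)))) (t := J) (f := f) (by simp [hJd])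
      (fun k _ => hfJ k)
    rcases lt_or_gt_of_ne hab with h | h
    · obtain ⟨rfl, rfl⟩ := hdouble a b h hfab
      exact hfab
    · obtain ⟨rfl, rfl⟩ := hdouble b a h hfab.symm
      exact hfab.symm
  set τ : Fin d → ℕ := fun k => if k ≤ j then f k.castSucc else f k.succ with hτ
  have hτJ : ∀ k, τ k ∈ J := by
    intro k
    simp only [hτ]
    split_ifs <;> exact hfJ _
  have hmem : (⟨j, τ⟩ : Σ _ : Fin d, Fin d → ℕ) ∈ stabFamily d 0 n := by
    rw [mem_stabFamily]
    intro k
    have hkd := k.isLt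
    have hpos : (0 : ℝ) < τ k := by exact_mod_cast (hJn _ (hτJ k)).1
    have hle : (τ k : ℝ) ≤ n := by exact_mod_cast (hJn _ (hτJ k)).2
    have hnU : ((d + 2 : ℕ) : ℝ) * ((n : ℝ) / (d + 2)) = n := by
      have : (d : ℝ) + 2 ≠ 0 := by positivity
      push_cast; field_simp
    rcases lt_trichotomy k j with hkj | hkj | hkj
    · have hτk : τ k = f k.castSucc := if_pos hkj.le
      have hlow : lowerEnd d j k = k := by simp [lowerEnd, Fin.lt_def.mp hkj]
      have hupp : upperEnd j k = k + 1 := by simp [upperEnd, Fin.lt_def.mp hkj]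
      have hkj' := Fin.lt_def.mp hkj
      apply mem_vertexRange_zero
      · rw [hlow]
        rcases Nat.eq_zero_or_pos (k : ℕ) with h0 | h0
        · rw [h0]; simpa using hpos
        · set m : Fin d := ⟨(k : ℕ) - 1, by omega⟩ with hm
          have hmv : (m : ℕ) = k - 1 := rfl
          have e := (hf k.castSucc).1 m (by simp; omega)
          rw [hyp m (Fin.lt_def.mpr (by omega)), ← hτk] at e
          have e' := (hP m _ (hτJ k)).2 e
          rwa [show numP d m = k by unfold numP; split_ifs <;> omega] at e'
      · rw [hupp]
        have e := (hf k.castSucc).2 k (by simp)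
        rw [hyp k hkj, ← hτk] at e
        have e' := (hP k _ (hτJ k)).1 e
        rwa [show numP d k = k + 1 by unfold numP; split_ifs <;> omega] at e'
    · have hτk : τ k = f k.castSucc := if_pos hkj.le
      subst hkj
      have e1 : y k ≤ x k (τ k) := by
        rw [hτk, hfj]; exact (hf k.succ).1 k (by simp)
      have e2 : x k (τ k) ≤ y k := by
        rw [hτk]; exact (hf k.castSucc).2 k (by simp)
      have e3 := (hP k _ (hτJ k)).2 (hyj1.trans e1)
      have e4 := (hQ k _ (hτJ k)).1 (e2.trans hyj2)
      apply mem_vertexRange_zero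
      · simpa [lowerEnd] using e3
      · rcases Nat.eq_zero_or_pos (k : ℕ) with h0 | h0
        -- On the segment of direction 0 the sharper upper bound comes from the coordinate of `q`
        -- after it: 3 units, whereas `q 0` only gives `n`.
        · set m : Fin d := ⟨1, by omega⟩ with hm
          have hmv : (m : ℕ) = 1 := rfl
          have e := (hf k.succ).2 m (by simp; omega)
          rw [hyq m (Fin.lt_def.mpr (by omega)), ← hfj, ← hτk] at e
          have e' := (hQ m _ (hτJ k)).1 e
          rw [show numQ d m = 3 by simp [numQ, hmv]] at e'
          simpa [upperEnd, h0] using e'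
        · rw [show numQ d k = upperEnd k k by unfold upperEnd numQ; split_ifs <;> omega] at e4
          exact e4
    · have hτk : τ k = f k.succ := if_neg (not_le.mpr hkj)
      have hkj' := Fin.lt_def.mp hkj
      have hlow : lowerEnd d j k = k + 2 := by unfold lowerEnd; split_ifs <;> omega
      have hupp : upperEnd j k = k + 3 := by unfold upperEnd; split_ifs <;> omega
      apply mem_vertexRange_zero
      · rw [hlow]
        have e := (hf k.succ).1 k (by simp)
        rw [hyq k hkj, ← hτk] at e
        have e' := (hQ k _ (hτJ k)).2 e
        rwa [show numQ d k = k + 2 by unfold numQ; split_ifs <;> omega] at e'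
      · rw [hupp]
        rcases Nat.lt_or_ge ((k : ℕ) + 1) d with hk1 | hk1
        · set m : Fin d := ⟨(k : ℕ) + 1, hk1⟩ with hm
          have hmv : (m : ℕ) = k + 1 := rfl
          have e := (hf k.succ).2 m (by simp [hmv])
          rw [hyq m (Fin.lt_def.mpr (by omega)), ← hτk] at e
          have e' := (hQ m _ (hτJ k)).1 e
          rwa [show numQ d m = k + 3 by rw [numQ, hmv, if_neg (Nat.succ_ne_zero _)]] at e'
        -- The last vertex has no further coordinate to bound it, only the end `n` of the grid.
        · rw [show (k : ℕ) + 3 = d + 2 by omega, hnU]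
          exact hle
  refine ⟨j, τ, hmem, Finset.eq_of_subset_of_card_le ?_ ?_⟩
  · intro i hi
    obtain ⟨k, -, rfl⟩ := Finset.mem_image.mp hi
    exact hτJ k
  · rw [Finset.card_image_of_injective _ (strictMono_of_mem_stabFamily hmem).injective, hJd]
    simp

/-- Such a set is determined by one of its elements in `B` and the other `d - 1` elements. -/
theorem card_filter_not_disjoint_le (d n : ℕ) (B : Finset ℕ) :
    ((Finset.powersetCard d (Finset.Icc 1 n)).filter fun J => ¬ Disjoint J B).card ≤
      B.card * n ^ (d - 1) := by
  have hsub : ((Finset.powersetCard d (Finset.Icc 1 n)).filter fun J => ¬ Disjoint J B) ⊆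
      B.biUnion fun b => (Finset.powersetCard d (Finset.Icc 1 n)).filter fun J => b ∈ J := by
    intro J hJ
    rw [Finset.mem_filter, Finset.not_disjoint_iff] at hJ
    obtain ⟨hJ1, b, hbJ, hb⟩ := hJ
    exact Finset.mem_biUnion.mpr ⟨b, hb, Finset.mem_filter.mpr ⟨hJ1, hbJ⟩⟩
  refine (Finset.card_le_card hsub).trans (Finset.card_biUnion_le_card_mul _ _ _ fun b _ => ?_)
  have hcard : (Finset.powersetCard (d - 1) (Finset.Icc 1 n)).card ≤ n ^ (d - 1) := by
    rw [Finset.card_powersetCard, Nat.card_Icc, Nat.add_sub_cancel]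
    exact Nat.choose_le_pow n (d - 1)
  refine le_trans ?_ hcard
  refine Finset.card_le_card_of_injOn (fun J => J.erase b) ?_ ?_
  · intro J hJ
    have hJ := Finset.mem_filter.mp (Finset.mem_coe.mp hJ)
    have hJ1 := Finset.mem_powersetCard.mp hJ.1
    refine Finset.mem_coe.mpr (Finset.mem_powersetCard.mpr
      ⟨(Finset.erase_subset _ _).trans hJ1.1, ?_⟩)
    rw [Finset.card_erase_of_mem hJ.2, hJ1.2]
  · intro J hJ J' hJ' h
    have hb := (Finset.mem_filter.mp (Finset.mem_coe.mp hJ)).2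
    have hb' := (Finset.mem_filter.mp (Finset.mem_coe.mp hJ')).2
    rw [← Finset.insert_erase hb, ← Finset.insert_erase hb']
    exact congrArg (insert b) h

theorem stairStabCount_le (hd : 3 ≤ d) (hx : IsStretchedGrid n x)
    (hq : Corresponds n x (pathQ d) q) (hp : Corresponds n x (pathP d) p)
    (hn : 5 * ((d : ℝ) + 2) ≤ n) :
    stairStabCount (stretchedDiagonal n x) (stairPath d q p) ≤
      (stabFamily d 0 n).card + 4 * d * n ^ (d - 1) := by
  classical
  set F := (stabFamily d 0 n).image fun s => vertexSet x s.2 with hF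
  set G := ((Finset.powersetCard d (Finset.Icc 1 n)).filter
    fun J => ¬ Disjoint J (boundaryIndices d n)).image
      (fun J : Finset ℕ => J.image (diagPoint x)) with hG
  have hsub : {Z : Finset (Fin d → ℝ) | (Z : Set (Fin d → ℝ)) ⊆ stretchedDiagonal n x ∧
      Z.card = d ∧ (stairPath d q p ∩ stconv (Z : Set (Fin d → ℝ))).Nonempty} ⊆
      ((F ∪ G : Finset (Finset (Fin d → ℝ))) : Set (Finset (Fin d → ℝ))) := by
    rintro Z ⟨hZ1, hZ2, hZ3⟩
    set J := (Finset.Icc 1 n).filter fun i => diagPoint x i ∈ Z with hJ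
    have hJZ : J.image (diagPoint x) = Z := by
      ext z
      constructor
      · intro hz
        obtain ⟨i, hi, rfl⟩ := Finset.mem_image.mp hz
        exact (Finset.mem_filter.mp hi).2
      · intro hz
        have hz' := hZ1 hz
        rw [stretchedDiagonal_eq] at hz'
        obtain ⟨i, hi, rfl⟩ := hz'
        exact Finset.mem_image_of_mem _
          (Finset.mem_filter.mpr ⟨Finset.mem_Icc.mpr ⟨hi.1, hi.2⟩, hz⟩)
    have hJn : J ⊆ Finset.Icc 1 n := Finset.filter_subset _ _
    have hJd : J.card = d := by
      rw [← hZ2, ← hJZ, Finset.card_image_of_injOn]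
      exact (hx.diagPoint_injOn (by omega)).mono fun i hi => by
        have := Finset.mem_Icc.mp (hJn hi)
        exact ⟨this.1, this.2⟩
    rw [Finset.mem_coe, Finset.mem_union]
    by_cases hdis : Disjoint J (boundaryIndices d n)
    · left
      obtain ⟨j, τ, hτ, hτJ⟩ := exists_mem_stabFamily_of_meets hd hx hq hp hn hJn hJd hdis (by
        rw [← Finset.coe_image, hJZ]; exact hZ3)
      refine Finset.mem_image.mpr ⟨⟨j, τ⟩, hτ, ?_⟩
      rw [← hJZ, ← hτJ, Finset.image_image]
      apply Finset.coe_injective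
      rw [coe_vertexSet]
      simp [Function.comp_def]
    · right
      exact Finset.mem_image.mpr ⟨J, Finset.mem_filter.mpr
        ⟨Finset.mem_powersetCard.mpr ⟨hJn, hJd⟩, hdis⟩, hJZ⟩
  refine (Set.ncard_le_ncard hsub (Finset.finite_toSet _)).trans ?_
  rw [Set.ncard_coe_finset]
  refine (Finset.card_union_le _ _).trans (add_le_add Finset.card_image_le ?_)
  refine Finset.card_image_le.trans ((card_filter_not_disjoint_le d n _).trans ?_)
  exact Nat.mul_le_mul_right _ (card_boundaryIndices_le d n)

theorem card_stabFamily_le_stairStabCount (hd : 3 ≤ d) (hx : IsStretchedGrid n x)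
    (hq : Corresponds n x (pathQ d) q) (hp : Corresponds n x (pathP d) p)
    (hn : 5 * ((d : ℝ) + 2) ≤ n) :
    (stabFamily d 5 n).card ≤ stairStabCount (stretchedDiagonal n x) (stairPath d q p) :=
  card_stabFamily_le (by omega) hx _ fun _ _ h => stairPath_meets_stconv hd hx hq hp hn h

/-- The clearance 5 is what the straight line needs; the stair-path meets the simplices of the
family for any clearance. -/
theorem card_stabFamily_le_stabCount (hd : 3 ≤ d) (hx : IsStretchedGrid n x)
    (hq : Corresponds n x (pathQ d) q) (hp : Corresponds n x (pathP d) p)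
    (hn : 5 * ((d : ℝ) + 2) ≤ n) :
    (stabFamily d 5 n).card ≤
      stabCount (stretchedDiagonal n x) (line[ℝ, q, p] : Set (Fin d → ℝ)) := by
  refine card_stabFamily_le (by omega) hx _ fun j τ h => ?_
  rw [mem_stabFamily] at h
  obtain ⟨h1, h2⟩ := line_meets_diagonal_simplex hd hx hq hp hn j τ
    (fun k => (mem_vertexRange (h k)).1.le) (fun k => (mem_vertexRange (h k)).2)
  rw [coe_vertexSet]
  refine ⟨?_, h2⟩
  exact h1.range.mono (s := ((vertexSet x τ : Finset (Fin d → ℝ)) : Set (Fin d → ℝ)))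
    (coe_vertexSet x τ).le

end

end StairConvex
namespace StairConvex

/-! ### Asymptotics -/

theorem isLittleO_sub_of_tendsto {d : ℕ} {f : ℕ → ℝ} {a : ℝ}
    (h : Tendsto (fun n : ℕ => f n / (n : ℝ) ^ d) atTop (nhds a)) :
    (fun n : ℕ => f n - a * (n : ℝ) ^ d) =o[atTop] fun n : ℕ => (n : ℝ) ^ d := by
  rw [isLittleO_iff_tendsto' ?_]
  · have h' := h.sub_const a
    rw [sub_self] at h'
    refine h'.congr' ?_
    filter_upwards [eventually_ge_atTop 1] with n hn
    have : (n : ℝ) ^ d ≠ 0 := pow_ne_zero _ (by positivity)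
    field_simp
  · filter_upwards [eventually_ge_atTop 1] with n hn h0
    have : (n : ℝ) ^ d ≠ 0 := pow_ne_zero _ (by positivity)
    exact absurd h0 this

section

variable {d : ℕ} {x : ℕ → Fin d → ℕ → ℝ} {q p : ℕ → Fin d → ℝ}

theorem eventually_large (d : ℕ) : ∀ᶠ n : ℕ in atTop, 1 ≤ n ∧ 5 * ((d : ℝ) + 2) ≤ n :=
  (eventually_ge_atTop 1).and (tendsto_natCast_atTop_atTop.eventually_ge_atTop _)

/-- Squeezed between the families with clearance 5 and 0, whose sizes have the same leading term. -/
theorem tendsto_stairStabCount (hd : 3 ≤ d) (hx : ∀ n, IsStretchedGrid n (x n))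
    (hqp : ∀ n, 1 ≤ n →
      Corresponds n (x n) (pathQ d) (q n) ∧ Corresponds n (x n) (pathP d) (p n)) :
    Tendsto (fun n : ℕ =>
      (stairStabCount (stretchedDiagonal n (x n)) (stairPath d (q n) (p n)) : ℝ) / (n : ℝ) ^ d)
      atTop (nhds (1 / ((d : ℝ) + 2) ^ (d - 1))) := by
  have hup : Tendsto (fun n : ℕ => ((stabFamily d 0 n).card : ℝ) / (n : ℝ) ^ d +
      4 * d / n) atTop (nhds (1 / ((d : ℝ) + 2) ^ (d - 1))) := by
    have := (tendsto_card_stabFamily hd 0).add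
      (tendsto_const_div_atTop_nhds_zero_nat (4 * (d : ℝ)))
    rwa [add_zero] at this
  refine tendsto_of_tendsto_of_tendsto_of_le_of_le' (tendsto_card_stabFamily hd 5) hup ?_ ?_
  · filter_upwards [eventually_large d] with n hn
    obtain ⟨hq, hp⟩ := hqp n hn.1
    have := card_stabFamily_le_stairStabCount hd (hx n) hq hp hn.2
    gcongr
  · filter_upwards [eventually_large d] with n hn
    obtain ⟨hq, hp⟩ := hqp n hn.1
    have h := stairStabCount_le hd (hx n) hq hp hn.2
    have h' : (stairStabCount (stretchedDiagonal n (x n)) (stairPath d (q n) (p n)) : ℝ) ≤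
        (stabFamily d 0 n).card + 4 * d * (n : ℝ) ^ (d - 1) := by exact_mod_cast h
    have hn0 : (0 : ℝ) < n := by exact_mod_cast hn.1
    have hpow : (n : ℝ) ^ d = n ^ (d - 1) * n := by
      rw [← pow_succ]; congr 1; omega
    calc _ ≤ ((stabFamily d 0 n).card + 4 * d * (n : ℝ) ^ (d - 1)) / (n : ℝ) ^ d := by gcongr
      _ = _ := by
        rw [add_div]
        congr 1
        rw [hpow]
        field_simp

/-- The number of simplices met by the lines is asymptotically at least
`n ^ d / (d + 2) ^ (d - 1)`. -/
theorem exists_error_le_stabCount (hd : 3 ≤ d) (hx : ∀ n, IsStretchedGrid n (x n))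
    (hqp : ∀ n, 1 ≤ n →
      Corresponds n (x n) (pathQ d) (q n) ∧ Corresponds n (x n) (pathP d) (p n)) :
    ∃ e : ℕ → ℝ, e =o[atTop] (fun n : ℕ => (n : ℝ) ^ d) ∧
      ∀ n : ℕ, (n : ℝ) ^ d / ((d : ℝ) + 2) ^ (d - 1) - e n ≤
        (stabCount (stretchedDiagonal n (x n)) (line[ℝ, q n, p n] : Set (Fin d → ℝ)) : ℝ) := by
  -- Taking the positive part of the deficit as error makes the inequality automatic for every `n`,
  -- small ones included.
  refine ⟨fun n => max 0 ((n : ℝ) ^ d / ((d : ℝ) + 2) ^ (d - 1) -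
    stabCount (stretchedDiagonal n (x n)) (line[ℝ, q n, p n] : Set (Fin d → ℝ))), ?_, fun n => ?_⟩
  · refine IsBigO.trans_isLittleO (IsBigO.of_bound 1 ?_)
      (isLittleO_sub_of_tendsto (tendsto_card_stabFamily hd 5))
    filter_upwards [eventually_large d] with n hn
    obtain ⟨hq, hp⟩ := hqp n hn.1
    have h : ((stabFamily d 5 n).card : ℝ) ≤
        stabCount (stretchedDiagonal n (x n)) (line[ℝ, q n, p n] : Set (Fin d → ℝ)) := by
      exact_mod_cast card_stabFamily_le_stabCount hd (hx n) hq hp hn.2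
    rw [one_mul, Real.norm_eq_abs, Real.norm_eq_abs, abs_of_nonneg (le_max_left _ _)]
    refine max_le (abs_nonneg _) ?_
    refine le_trans ?_ (neg_le_abs _)
    rw [one_div_mul_eq_div]
    linarith
  · have := le_max_right (0 : ℝ) ((n : ℝ) ^ d / ((d : ℝ) + 2) ^ (d - 1) -
      stabCount (stretchedDiagonal n (x n)) (line[ℝ, q n, p n] : Set (Fin d → ℝ)))
    linarith

theorem le_of_yieldsUpperBound (hd : 3 ≤ d) (hx : ∀ n, IsStretchedGrid n (x n))
    (hqp : ∀ n, 1 ≤ n →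
      Corresponds n (x n) (pathQ d) (q n) ∧ Corresponds n (x n) (pathP d) (p n)) {c : ℝ}
    (hc : YieldsUpperBound x c) : 1 / ((d : ℝ) + 2) ^ (d - 1) ≤ c := by
  obtain ⟨e, he, hce⟩ := hc
  have hlim : Tendsto (fun n : ℕ => c + e n / (n : ℝ) ^ d) atTop (nhds c) := by
    simpa using tendsto_const_nhds.add he.tendsto_div_nhds_zero
  refine le_of_tendsto_of_tendsto (tendsto_card_stabFamily hd 5) hlim ?_
  filter_upwards [eventually_large d] with n hn
  obtain ⟨hq, hp⟩ := hqp n hn.1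
  have hne : q n ≠ p n := fun h => by
    have := pathP_lt_pathQ (by omega) (hx n) hq hp hn.2 ⟨0, by omega⟩
    rw [h] at this
    exact lt_irrefl _ this
  -- The assumed bound speaks of genuine lines, so the two points must be distinct.
  have hdir : Module.finrank ℝ (line[ℝ, q n, p n]).direction = 1 := by
    rw [direction_affineSpan, vectorSpan_pair, finrank_span_singleton]
    exact vsub_ne_zero.mpr hne
  have h1 := hce n _ hdir
  have h2 : ((stabFamily d 5 n).card : ℝ) ≤
      stabCount (stretchedDiagonal n (x n)) (line[ℝ, q n, p n] : Set (Fin d → ℝ)) := by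
    exact_mod_cast card_stabFamily_le_stabCount hd (hx n) hq hp hn.2
  have hn0 : (0 : ℝ) < (n : ℝ) ^ d := pow_pos (by exact_mod_cast hn.1) d
  rw [div_le_iff₀ hn0, add_mul, div_mul_cancel₀ _ hn0.ne']
  linarith

theorem exists_corresponds_pathQ_pathP (hx : ∀ n, IsStretchedGrid n (x n)) :
    ∃ q p : ℕ → Fin d → ℝ, ∀ n, 1 ≤ n →
      Corresponds n (x n) (pathQ d) (q n) ∧ Corresponds n (x n) (pathP d) (p n) := by
  have hd2 : (0 : ℝ) < (d : ℝ) + 2 := by positivity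
  have hQ : ∀ i, 0 ≤ pathQ d i ∧ pathQ d i ≤ 1 := by
    intro i
    have hi : (i : ℝ) + 1 ≤ d := by exact_mod_cast i.isLt
    have hi0 : (0 : ℝ) ≤ i := Nat.cast_nonneg _
    rw [pathQ]
    split_ifs
    · norm_num
    · exact ⟨by positivity, (div_le_one hd2).mpr (by linarith)⟩
  have hP : ∀ i, 0 ≤ pathP d i ∧ pathP d i ≤ 1 := by
    intro i
    have hi : (i : ℝ) + 1 ≤ d := by exact_mod_cast i.isLt
    have hi0 : (0 : ℝ) ≤ i := Nat.cast_nonneg _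
    rw [pathP]
    split_ifs
    · exact ⟨div_nonneg (by linarith) hd2.le, (div_le_one hd2).mpr (by linarith)⟩
    · exact ⟨by positivity, (div_le_one hd2).mpr (by linarith)⟩
  have h : ∀ n, ∃ qp : (Fin d → ℝ) × (Fin d → ℝ), 1 ≤ n →
      Corresponds n (x n) (pathQ d) qp.1 ∧ Corresponds n (x n) (pathP d) qp.2 := by
    intro n
    by_cases hn : 1 ≤ n
    · obtain ⟨q, hq⟩ := exists_corresponds (hx n) hn (fun i => (hQ i).1) fun i => (hQ i).2
      obtain ⟨p, hp⟩ := exists_corresponds (hx n) hn (fun i => (hP i).1) fun i => (hP i).2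
      exact ⟨(q, p), fun _ => ⟨hq, hp⟩⟩
    · exact ⟨(0, 0), fun h => absurd h hn⟩
  choose f hf using h
  exact ⟨fun n => (f n).1, fun n => (f n).2, hf⟩

end

end StairConvex

/-! ### The theorem -/

open StairConvex in
theorem theorem2 (d : ℕ) (hd : 3 ≤ d) (x : ℕ → Fin d → ℕ → ℝ)
    (hx : ∀ n, IsStretchedGrid n (x n)) :
    (∃ q p : ℕ → Fin d → ℝ, ∀ n, 1 ≤ n →
      Corresponds n (x n) (pathQ d) (q n) ∧ Corresponds n (x n) (pathP d) (p n)) ∧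
    (∀ q p : ℕ → Fin d → ℝ,
      (∀ n, 1 ≤ n →
        Corresponds n (x n) (pathQ d) (q n) ∧ Corresponds n (x n) (pathP d) (p n)) →
      ((fun n : ℕ =>
          (stairStabCount (stretchedDiagonal n (x n)) (stairPath d (q n) (p n)) : ℝ)
            - (n : ℝ) ^ d / ((d : ℝ) + 2) ^ (d - 1))
        =o[atTop] fun n : ℕ => (n : ℝ) ^ d) ∧
      ∃ e : ℕ → ℝ, e =o[atTop] (fun n : ℕ => (n : ℝ) ^ d) ∧
        ∀ n : ℕ, (n : ℝ) ^ d / ((d : ℝ) + 2) ^ (d - 1) - e n ≤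
          (stabCount (stretchedDiagonal n (x n))
            (line[ℝ, q n, p n] : Set (Fin d → ℝ)) : ℝ)) ∧
    (∀ c : ℝ, YieldsUpperBound x c →
      1 / ((d : ℝ) + 2) ^ (d - 1) ≤ c ∧
      (d = 4 → 0.00457936 < c) ∧
      (d = 5 → 0.000405335 < c) ∧
      (d = 6 → 0.0000291323 < c)) := by
  refine ⟨exists_corresponds_pathQ_pathP hx, fun q p hqp => ⟨?_, ?_⟩, fun c hc => ?_⟩
  · refine (isLittleO_sub_of_tendsto (tendsto_stairStabCount hd hx hqp)).congr_left fun n => ?_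
    rw [one_div_mul_eq_div]
  · exact exists_error_le_stabCount hd hx hqp
  · obtain ⟨q, p, hqp⟩ := exists_corresponds_pathQ_pathP hx
    have h := le_of_yieldsUpperBound hd hx hqp hc
    refine ⟨h, ?_, ?_, ?_⟩
    -- The bounds are `1 / 6 ^ 3`, `1 / 7 ^ 4` and `1 / 8 ^ 5`.
    all_goals
      rintro rfl
      refine lt_of_lt_of_le ?_ h
      norm_num
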